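/- Let $k$ be a field. For a $k$-algebra $B$ write $B^e=B\otimes_k B^{\mathrm{op}}$; the right $B^e$-module structure of $B^e$ makes every $\mathrm{Ext}^i_{B^e}(B,B^e)$ a $B$-bimodule. Call $B$ skew-Calabi–Yau of dimension $n\in\mathbb N$ if $B$ has a finite resolution by finitely generated projective $B$-bimodules, $\mathrm{Ext}^i_{B^e}(B,B^e)=0$ for $i\neq n$, and $\mathrm{Ext}^n_{B^e}(B,B^e)\simeq B^\sigma$ as $B$-bimodules for some $\sigma\in\mathrm{Aut}_{k\text{-alg}}(B)$, where $B^\sigma$ is $B$ with bimodule structure $a\cdot x\cdot b=ax\sigma(b)$; call $B$ Calabi–Yau if this holds for some $n$ with $\sigma=\mathrm{id}_B$. Let $A$ be a skew-Calabi–Yau $k$-algebra of dimension $n$, put $D=\mathrm{Ext}^n_{A^e}(A,A^e)$, let $e$ be a free generator of the left $A$-module $D$, and let $\mu_A\in\mathrm{Aut}_{k\text{-alg}}(A)$ be the corresponding Nakayama automorphism, determined by $ea=\mu_A(a)e$ for all $a\in A$. The group $\langle\mu_A\rangle$ acts on $A$ by automorphisms and hence, naturally, on $D$, by $g\rightharpoonup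 x$. Let $f\colon D\to A$ be the left $A$-linear map with $f(e)=1$, and let $\mathrm{whdet}\colon k\langle\mu_A\rangle\to A$ be the weak homological determinant associated with $e$, i.e. the $k$-linear map such that $g\bigl(f(g^{-1}\rightharpoonup x)\bigr)=f(x)\,\mathrm{whdet}(g)$ for all $g\in\langle\mu_A\rangle$ and $x\in D$. Assume that (a) $\mathrm{whdet}(\mu_A)=1$; (b) if $\mu_A$ has finite order, then $\mathrm{char}(k)$ does not divide this order. Then the smash product (skew group algebra) $A\sharp\langle\mu_A\rangle$, that is, the free left $A$-module on $\langle\mu_A\rangle$ with product $(ag)(bh)=a\,g(b)\,gh$, is Calabi–Yau. -/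

import Mathlib

open CategoryTheory TensorProduct

universe u v

namespace CYSmash

noncomputable section

/-- The enveloping algebra `Aᵉ = A ⊗ Aᵒᵖ` of a `k`-algebra. -/
abbrev Env (k : Type u) (A : Type v) [Field k] [Ring A] [Algebra k A] : Type v :=
  A ⊗[k] Aᵐᵒᵖ

section Duality

variable (k : Type u) (A : Type v) [Field k] [Ring A] [Algebra k A]

/-- The regular bimodule `A` as a left `Aᵉ`-module: `(a ⊗ b) • x = a x b`. -/
def regularBimodule : ModuleCat.{v} (Env k A) :=
  letI : Module (Env k A) A := instModuleTensorProductMop k A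
  ModuleCat.of (Env k A) A

/-- `Aᵉ` as a left module over itself. -/
abbrev envModule : ModuleCat.{v} (Env k A) := ModuleCat.of (Env k A) (Env k A)

/-- `A` has a finite resolution by finitely generated projective `A`-bimodules. -/
def IsHomologicallySmooth : Prop :=
  ∃ (P : ProjectiveResolution (regularBimodule k A)) (m : ℕ),
    (∀ i, Module.Finite (Env k A) (P.complex.X i)) ∧
    ∀ i, m < i → Limits.IsZero (P.complex.X i)

/-- The group `Ext^i_{Aᵉ}(A, Aᵉ)`. -/
abbrev DualExt (i : ℕ) : Type v := Abelian.Ext (regularBimodule k A) (envModule k A) i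

variable {k A}

/-- Right multiplication by `r` on `Aᵉ`; it is left `Aᵉ`-linear. -/
def rightMul (r : Env k A) : envModule k A ⟶ envModule k A :=
  ModuleCat.ofHom (LinearMap.toSpanSingleton (Env k A) (Env k A) r)

/-- The left action of `A` on `Ext^i_{Aᵉ}(A, Aᵉ)`, induced by the endomorphism
`x ⊗ y ↦ (x ⊗ y)(1 ⊗ a) = x ⊗ a y` of `Aᵉ` (the product `a y` being that of `A`). -/
def lact {i : ℕ} (a : A) (x : DualExt k A i) : DualExt k A i :=
  x.comp (Abelian.Ext.mk₀ (rightMul (1 ⊗ₜ[k] MulOpposite.op a))) (add_zero i)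

/-- The right action of `A` on `Ext^i_{Aᵉ}(A, Aᵉ)`, induced by the endomorphism
`x ⊗ y ↦ (x ⊗ y)(a ⊗ 1) = x a ⊗ y` of `Aᵉ`. -/
def ract {i : ℕ} (x : DualExt k A i) (a : A) : DualExt k A i :=
  x.comp (Abelian.Ext.mk₀ (rightMul (a ⊗ₜ[k] 1))) (add_zero i)

variable (k A)

/-- `σ` is a Nakayama automorphism of `A` in dimension `n`: the `A`-bimodule
`Ext^n_{Aᵉ}(A, Aᵉ)` is isomorphic to `A^σ`, that is to `A` with `a · x · b = a x σ(b)`. -/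
def IsNakayama (n : ℕ) (σ : A ≃ₐ[k] A) : Prop :=
  ∃ φ : DualExt k A n ≃+ A,
    ∀ (a b : A) (x : DualExt k A n), φ (ract (lact a x) b) = a * φ x * σ b

/-- `A` is skew-Calabi–Yau of dimension `n`. -/
def IsSkewCalabiYau (n : ℕ) : Prop :=
  IsHomologicallySmooth k A ∧ (∀ i, i ≠ n → Subsingleton (DualExt k A i)) ∧
    ∃ σ : A ≃ₐ[k] A, IsNakayama k A n σ

/-- `A` is Calabi–Yau of dimension `n`: `Ext^n_{Aᵉ}(A, Aᵉ)` is isomorphic to `A` itself. -/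
def IsCalabiYauOfDim (n : ℕ) : Prop :=
  IsHomologicallySmooth k A ∧ (∀ i, i ≠ n → Subsingleton (DualExt k A i)) ∧
    IsNakayama k A n AlgEquiv.refl

/-- `A` is Calabi–Yau (of some dimension). -/
def IsCalabiYau : Prop := ∃ n : ℕ, IsCalabiYauOfDim k A n

variable {k A}

/-- `e` is a free generator of the left `A`-module `Ext^n_{Aᵉ}(A, Aᵉ)`. -/
def IsFreeGenerator {n : ℕ} (e : DualExt k A n) : Prop :=
  ∀ x : DualExt k A n, ∃! a : A, x = lact a e

end Duality

section Action

variable {k : Type u} {A : Type v} [Field k] [Ring A] [Algebra k A]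

/-- The automorphism `a ⊗ b ↦ σ(a) ⊗ σ(b)` of `Aᵉ`. -/
def envAut (σ : A ≃ₐ[k] A) : Env k A ≃ₐ[k] Env k A :=
  Algebra.TensorProduct.congr σ (AlgEquiv.op σ)

/-- Twisting of `Aᵉ`-modules by `σ`: on the twisted module `r ∈ Aᵉ` acts as `σ⁻¹(r)` did. -/
abbrev twist (σ : A ≃ₐ[k] A) : ModuleCat.{v} (Env k A) ⥤ ModuleCat.{v} (Env k A) :=
  ModuleCat.restrictScalars (envAut σ).symm.toRingEquiv.toRingHom

theorem mulLeftRight_envAut (σ : A ≃ₐ[k] A) (r : Env k A) (x : A) :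
    AlgHom.mulLeftRight k A (envAut σ r) (σ x) = σ (AlgHom.mulLeftRight k A r x) := by
  induction r using TensorProduct.induction_on with
  | zero => simp
  | add r s hr hs => simp only [map_add, LinearMap.add_apply, hr, hs]
  | tmul a b => simp [envAut]

/-- `σ⁻¹`, as an `Aᵉ`-linear map from `A` to the twist of `A`. -/
def twistRegular (σ : A ≃ₐ[k] A) :
    regularBimodule k A ⟶ (twist σ).obj (regularBimodule k A) :=
  letI : Module (Env k A) A := instModuleTensorProductMop k A
  ModuleCat.ofHom (Y := (twist σ).obj (regularBimodule k A))
    { toFun := fun x : A => (σ.symm x : A)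
      map_add' := fun x y => map_add σ.symm x y
      map_smul' := fun r x => (mulLeftRight_envAut σ.symm r x).symm }

/-- `σ ⊗ σ`, as an `Aᵉ`-linear map from the twist of `Aᵉ` to `Aᵉ`. -/
def untwistEnv (σ : A ≃ₐ[k] A) : (twist σ).obj (envModule k A) ⟶ envModule k A :=
  ModuleCat.ofHom (X := (twist σ).obj (envModule k A))
    { toFun := fun y : Env k A => (envAut σ y : Env k A)
      map_add' := fun x y => map_add (envAut σ) x y
      map_smul' := fun r (y : Env k A) => by
        change envAut σ ((envAut σ).symm r * y) = r * envAut σ y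
        rw [map_mul, AlgEquiv.apply_symm_apply] }

/-- The natural action `σ ⇀ x` of algebra automorphisms of `A` on `Ext^i_{Aᵉ}(A, Aᵉ)`.
If `P → A` is a projective resolution of `A` over `Aᵉ` with a compatible action of `σ` on `P`
(that is, `σ(a p b) = σ(a) σ(p) σ(b)`) and `x` is the class of a cocycle `f : P_i → Aᵉ`, then
`σ ⇀ x` is the class of `p ↦ (σ ⊗ σ)(f(σ⁻¹ p))`. -/
def autAct {i : ℕ} (σ : A ≃ₐ[k] A) (x : DualExt k A i) : DualExt k A i :=
  ((Abelian.Ext.mk₀ (twistRegular σ)).comp (x.mapExactFunctor (twist σ)) (zero_add i)).comp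
    (Abelian.Ext.mk₀ (untwistEnv σ)) (add_zero i)

/-- Let `G` be a group of `k`-algebra automorphisms of `A` and let `e` be a free generator of the
left `A`-module `D = Ext^n_{Aᵉ}(A, Aᵉ)`. The linear map `w : kG → A` is the weak homological
determinant associated with `e`: if `f : D → A` is the left `A`-linear map with `f(e) = 1`, then
`g ⇀ f = f · w(g)` in `Hom_A(D, A)` for all `g ∈ G` (hence for all elements of `kG`, by linearity).
Here `(g ⇀ f)(x) = g(f(g⁻¹ ⇀ x))` and `(f · a)(x) = f(x) a`. -/
def IsWeakHomologicalDeterminant {n : ℕ} (G : Subgroup (A ≃ₐ[k] A)) (e : DualExt k A n)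
    (w : MonoidAlgebra k G →ₗ[k] A) : Prop :=
  ∃ f : DualExt k A n →+ A, (∀ a x, f (lact a x) = a * f x) ∧ f e = 1 ∧
    ∀ (g : G) (x : DualExt k A n),
      (g : A ≃ₐ[k] A) (f (autAct ((g : A ≃ₐ[k] A)⁻¹) x)) = f x * w (MonoidAlgebra.of k G g)

/-- The smash product `A ♯ kG` for a group `G` of `k`-algebra automorphisms of `A`: the free
left `A`-module on `G` with `(a g)(b h) = (a g(b)) (g h)`. -/
abbrev Smash (G : Subgroup (A ≃ₐ[k] A)) : Type v := SkewMonoidAlgebra A G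

end Action

end

end CYSmash

/-!
Write `G = ⟨μ⟩`, `B = A ♯ kG`, `Aᵉ` and `Bᵉ` for the enveloping algebras, and `D = Ext^n(A, Aᵉ)`.

The bimodule `C = B ⊗_A B = Bᵉ ⊗_{Aᵉ} A` has an endomorphism `τ : x ⊗ y ↦ x μ⁻¹ ⊗ μ y`
(`swapEnd`), which is well defined because `μ⁻¹ ⊗ μ` normalizes `Aᵉ` in `Bᵉ`. As an additive group,
`C` is the direct sum of copies of `B` indexed by `G`, where `τ` translates the index and the
multiplication `C → B` is the sum of the entries (`inducedCoord`). Hence `C → C → B → 0`, with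
first map `1 - τ`, is exact. If `μ` has infinite order, `1 - τ` is injective. If `μ` has finite
order `N`, prime to the characteristic, `C → B` is split by means of `N⁻¹ ∑_{i < N} τ^i`. In both
cases `B` inherits a finite resolution by finitely generated projective bimodules from `C`, and `C`
inherits one from `A` because `Bᵉ` is free as a right `Aᵉ`-module
(`RightBasis.hasFiniteResolution_induced`, `HasFiniteResolution.of_cokernel`).

By adjunction (`extAdj_bijective`) and finiteness (`ext_free_mem_closure`), the groups
`Ext^i(C, Bᵉ) ≅ Ext^i_{Aᵉ}(A, Bᵉ)` are generated by the images of `Ext^i(A, Aᵉ) ⊗ Bᵉ`, since `Bᵉ`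
is also free as a left `Aᵉ`-module. So they
vanish for `i ≠ n`. For `i = n`, the generator `e` of `D` and the relation `e a = μ(a) e` identify
them with a direct sum of copies of `B` indexed by `G` (`extCoord`): the entry `b` of index `g`
corresponds to `e ⊗ (g ⊗ b (μ g)⁻¹)`. The action of `τ` involves the action of `μ⁻¹` on `D`
(`adjExt_swapEnd_comp_of_eq_extend`). The condition `whdet(μ) = 1` says that this action fixes `e`
(`autAct_inv_eq_self`), and then `τ` is again the translation of the index
(`swapEnd_comp_extCoord`).

The kernel of `1 - τ` on `Ext^n(C, Bᵉ)` is therefore zero if `μ` has infinite order, and its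
cokernel is always `B`, by the sum of the entries. The long exact sequence of `0 → C → C → B → 0`,
or the splitting of `C → B`, shows that `Ext^i(B, Bᵉ)` vanishes in all degrees but one, where it is
this cokernel. The degree is `n + 1` for infinite order and `n` for finite order. The inner actions
of `B` match the multiplications of `B` from both sides without a twist (`isNakayama_refl`): the
twist by `μ` in `e a = μ(a) e` is absorbed by the factor `μ⁻¹` in `b (μ g)⁻¹`.
-/

namespace CYSmash

noncomputable section

/-! ### Ext groups, exact functors and adjunctions -/

section ExtGeneralities

open Abelian Limits

variable {C : Type*} [Category* C] [Abelian C] {D : Type*} [Category* D] [Abelian D]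
  {E : Type*} [Category* E] [Abelian E]

theorem exists_projective_presentation [EnoughProjectives C] (X : C) :
    ∃ S : ShortComplex C, S.ShortExact ∧ Projective S.X₂ ∧ S.X₃ = X :=
  ⟨ShortComplex.mk _ _ (kernel.condition (Projective.π X)),
    { exact := ShortComplex.exact_of_f_is_kernel _ (kernelIsKernel (Projective.π X)) },
    inferInstanceAs (Projective (Projective.over X)), rfl⟩

/-- Dimension shifting: Ext classes of positive degree are products with the class of a projective
presentation. -/
theorem exists_eq_extClass_comp [HasExt C] {S : ShortComplex C} (hS : S.ShortExact)
    [Projective S.X₂] {Y : C} {n : ℕ} (x : Ext S.X₃ Y (n + 1)) :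
    ∃ y : Ext S.X₁ Y n, hS.extClass.comp y (Nat.add_comm 1 n) = x :=
  Ext.contravariant_sequence_exact₃ hS Y x (Ext.eq_zero_of_projective _) _

/-- A property of Ext classes which holds in degree `0` and is inherited by
products with the class of a projective presentation holds for all Ext classes. -/
theorem ext_induction [EnoughProjectives C] [HasExt C] {Y : C}
    {p : ∀ {X : C} {n : ℕ}, Ext X Y n → Prop}
    (zero : ∀ {X : C} (f : X ⟶ Y), p (Ext.mk₀ f))
    (succ : ∀ {S : ShortComplex C} (hS : S.ShortExact) {n : ℕ} (x : Ext S.X₁ Y n), p x →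
      p (hS.extClass.comp x (Nat.add_comm 1 n)))
    {X : C} {n : ℕ} (x : Ext X Y n) : p x := by
  induction n generalizing X with
  | zero =>
    obtain ⟨f, rfl⟩ := (Ext.mk₀_bijective X Y).2 x
    exact zero f
  | succ n ih =>
    obtain ⟨S, hS, hP, rfl⟩ := exists_projective_presentation X
    obtain ⟨y, rfl⟩ := exists_eq_extClass_comp hS x
    exact succ _ y (ih y)

section Functors

variable [HasExt C] [HasExt D] [HasExt E]
  (F : C ⥤ D) [F.Additive] [PreservesFiniteLimits F] [PreservesFiniteColimits F]
  (H : D ⥤ E) [H.Additive] [PreservesFiniteLimits H] [PreservesFiniteColimits H]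

/-- The degree one case of `mapExactFunctor_naturality`, for the class of a short exact sequence. -/
theorem extClass_mapExactFunctor_naturality {F G : C ⥤ D} [F.Additive] [PreservesFiniteLimits F]
    [PreservesFiniteColimits F] [G.Additive] [PreservesFiniteLimits G] [PreservesFiniteColimits G]
    (α : F ⟶ G) {S : ShortComplex C} (hS : S.ShortExact) :
    (hS.extClass.mapExactFunctor F).comp (Ext.mk₀ (α.app S.X₁)) (add_zero 1) =
      (Ext.mk₀ (α.app S.X₃)).comp (hS.extClass.mapExactFunctor G) (zero_add 1) := by
  rw [Ext.mapExactFunctor_extClass, Ext.mapExactFunctor_extClass]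
  exact ShortComplex.ShortExact.extClass_naturality (hS.map_of_exact F) (hS.map_of_exact G)
      (S.mapNatTrans α)

/-- The action of exact functors on Ext is natural with respect to natural transformations. -/
theorem mapExactFunctor_naturality [EnoughProjectives C] {F G : C ⥤ D}
    [F.Additive] [PreservesFiniteLimits F] [PreservesFiniteColimits F]
    [G.Additive] [PreservesFiniteLimits G] [PreservesFiniteColimits G]
    (α : F ⟶ G) {X Y : C} {n : ℕ} (x : Ext X Y n) :
    (Ext.mk₀ (α.app X)).comp (x.mapExactFunctor G) (zero_add n) =
      (x.mapExactFunctor F).comp (Ext.mk₀ (α.app Y)) (add_zero n) := by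
  induction x using ext_induction with
  | zero f => simp [Ext.mapExactFunctor_mk₀]
  | succ hS x ih =>
    rw [Ext.mapExactFunctor_comp, Ext.mapExactFunctor_comp, Ext.comp_assoc_of_third_deg_zero, ← ih,
      ← Ext.comp_assoc (a₁₂ := 1) _ _ _ (by lia) (by lia) (by lia),
      ← extClass_mapExactFunctor_naturality, Ext.comp_assoc_of_second_deg_zero]

theorem mapExactFunctor_compFunctor [EnoughProjectives C] {X Y : C} {n : ℕ} (x : Ext X Y n) :
    x.mapExactFunctor (F ⋙ H) = (x.mapExactFunctor F).mapExactFunctor H := by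
  induction x using ext_induction with
  | zero f => simp only [Ext.mapExactFunctor_mk₀]; rfl
  | succ hS x ih =>
    have h : hS.extClass.mapExactFunctor (F ⋙ H) =
        (hS.extClass.mapExactFunctor F).mapExactFunctor H := by
      simp only [Ext.mapExactFunctor_extClass]
      exact (Ext.mapExactFunctor_extClass H (hS.map_of_exact F)).symm
    simp only [Ext.mapExactFunctor_comp, ih, h]

theorem exists_eq_extClass_map_comp {S : ShortComplex C} (hS : S.ShortExact)
    (hP : Projective (F.obj S.X₂)) {Y : D} {n : ℕ} (x : Ext (F.obj S.X₃) Y (n + 1)) :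
    ∃ y : Ext (F.obj S.X₁) Y n,
      (hS.extClass.mapExactFunctor F).comp y (Nat.add_comm 1 n) = x := by
  have : Projective (S.map F).X₂ := hP
  rw [Ext.mapExactFunctor_extClass]
  exact exists_eq_extClass_comp (hS.map_of_exact F) x

end Functors

section Adjunction

variable [HasExt C] [HasExt D] {F : C ⥤ D} {G : D ⥤ C} (adj : F ⊣ G)
  [G.Additive] [PreservesFiniteLimits G] [PreservesFiniteColimits G]

/-- The comparison map `Ext^n(F X, Y) → Ext^n(X, G Y)` of an adjunction with
exact right adjoint `G`: apply `G` and restrict along the unit. -/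
def extAdj (X : C) (Y : D) (n : ℕ) : Ext (F.obj X) Y n →+ Ext X (G.obj Y) n :=
  ((Ext.mk₀ (adj.unit.app X)).precomp (G.obj Y) (zero_add n)).comp
    (G.mapExtAddHom (F.obj X) Y n)

theorem extAdj_apply {X : C} {Y : D} {n : ℕ} (x : Ext (F.obj X) Y n) :
    extAdj adj X Y n x =
      (Ext.mk₀ (adj.unit.app X)).comp (x.mapExactFunctor G) (zero_add n) := rfl

theorem extAdj_comp {X : C} {Y Z : D} {n m p : ℕ} (x : Ext (F.obj X) Y n) (y : Ext Y Z m)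
    (h : n + m = p) :
    extAdj adj X Z p (x.comp y h) = (extAdj adj X Y n x).comp (y.mapExactFunctor G) h := by
  rw [extAdj_apply, extAdj_apply, Ext.mapExactFunctor_comp,
    Ext.comp_assoc _ _ _ (zero_add n) h (by lia)]

theorem extAdj_mk₀_comp {X X' : C} (f : X' ⟶ X) {Y : D} {n : ℕ} (x : Ext (F.obj X) Y n) :
    extAdj adj X' Y n ((Ext.mk₀ (F.map f)).comp x (zero_add n)) =
      (Ext.mk₀ f).comp (extAdj adj X Y n x) (zero_add n) := by
  rw [extAdj_apply, extAdj_apply, Ext.mapExactFunctor_comp, Ext.mapExactFunctor_mk₀,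
    ← Ext.comp_assoc (a₁₂ := 0) _ _ _ (by lia) (by lia) (by lia), Ext.mk₀_comp_mk₀,
    ← Ext.comp_assoc (a₁₂ := 0) _ _ _ (by lia) (by lia) (by lia), Ext.mk₀_comp_mk₀]
  congr 2
  exact (adj.unit.naturality f).symm

variable [F.Additive] [PreservesFiniteLimits F] [PreservesFiniteColimits F]

/-- The comparison maps commute with the connecting homomorphisms. -/
theorem extAdj_extClass_comp {S : ShortComplex C} (hS : S.ShortExact) {Y : D} {n : ℕ}
    (x : Ext (F.obj S.X₁) Y n) :
    extAdj adj S.X₃ Y (n + 1) ((hS.extClass.mapExactFunctor F).comp x (Nat.add_comm 1 n)) =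
      hS.extClass.comp (extAdj adj S.X₁ Y n x) (Nat.add_comm 1 n) := by
  have h : hS.extClass.comp (Ext.mk₀ (adj.unit.app S.X₁)) (add_zero 1) =
      (Ext.mk₀ (adj.unit.app S.X₃)).comp ((hS.extClass.mapExactFunctor F).mapExactFunctor G)
        (zero_add 1) := by
    have e : (hS.extClass.mapExactFunctor F).mapExactFunctor G =
        ((hS.map_of_exact F).map_of_exact G).extClass := by
      rw [Ext.mapExactFunctor_extClass F hS]
      exact Ext.mapExactFunctor_extClass G (hS.map_of_exact F)
    rw [e]
    exact ShortComplex.ShortExact.extClass_naturality hS ((hS.map_of_exact F).map_of_exact G)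
      { τ₁ := adj.unit.app S.X₁
        τ₂ := adj.unit.app S.X₂
        τ₃ := adj.unit.app S.X₃
        comm₁₂ := (adj.unit.naturality S.f).symm
        comm₂₃ := (adj.unit.naturality S.g).symm }
  rw [extAdj_apply, extAdj_apply, Ext.mapExactFunctor_comp,
    ← Ext.comp_assoc (a₁₂ := 1) _ _ _ (by lia) (by lia) (by lia)]
  erw [← h]
  rw [Ext.comp_assoc_of_second_deg_zero]

/-- An adjunction of exact functors induces isomorphisms of Ext groups. By dimension shifting this
reduces to degree `0`, since `F` maps projective presentations to projective presentations. -/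
theorem extAdj_bijective [EnoughProjectives C] (X : C) (Y : D) (n : ℕ) :
    Function.Bijective (extAdj adj X Y n) := by
  induction n generalizing X with
  | zero =>
    have key : ∀ f : F.obj X ⟶ Y, extAdj adj X Y 0 (Ext.mk₀ f) = Ext.mk₀ (adj.homEquiv X Y f) := by
      intro f
      rw [extAdj_apply, Ext.mapExactFunctor_mk₀, Ext.mk₀_comp_mk₀, adj.homEquiv_unit]
    constructor
    · intro x y hxy
      obtain ⟨f, rfl⟩ := (Ext.mk₀_bijective _ _).2 x
      obtain ⟨g, rfl⟩ := (Ext.mk₀_bijective _ _).2 y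
      rw [key, key] at hxy
      rw [(adj.homEquiv X Y).injective ((Ext.mk₀_bijective _ _).1 hxy)]
    · intro y
      obtain ⟨g, rfl⟩ := (Ext.mk₀_bijective _ _).2 y
      exact ⟨Ext.mk₀ ((adj.homEquiv X Y).symm g), by rw [key, Equiv.apply_symm_apply]⟩
  | succ n ih =>
    obtain ⟨S, hS, hP, rfl⟩ := exists_projective_presentation X
    have hFP : Projective (F.obj S.X₂) := adj.map_projective _ hP
    constructor
    · rw [injective_iff_map_eq_zero]
      intro y hy
      obtain ⟨y', rfl⟩ := exists_eq_extClass_map_comp F hS hFP y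
      rw [extAdj_extClass_comp adj hS y'] at hy
      obtain ⟨z, hz⟩ := Ext.contravariant_sequence_exact₁ hS _ _ _ hy
      obtain ⟨z, rfl⟩ := (ih S.X₂).2 z
      rw [← extAdj_mk₀_comp] at hz
      rw [← (ih S.X₁).1 hz, ← Ext.mapExactFunctor_mk₀,
        ← Ext.comp_assoc (a₁₂ := 1) _ _ _ (by lia) (by lia) (by lia), ← Ext.mapExactFunctor_comp,
        ShortComplex.ShortExact.extClass_comp, Ext.mapExactFunctor_zero, Ext.zero_comp]
    · intro x
      obtain ⟨x', rfl⟩ := exists_eq_extClass_comp hS (n := n) x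
      obtain ⟨y, rfl⟩ := (ih S.X₁).2 x'
      exact ⟨_, extAdj_extClass_comp adj hS y⟩

end Adjunction

end ExtGeneralities

section TwistedAdjunction

open Abelian Limits

variable {C : Type*} {D : Type*} [Category* C] [Abelian C] [Category* D] [Abelian D]
  [HasExt C] [HasExt D] [EnoughProjectives D] {F : C ⥤ D} {G : D ⥤ C} (adj : F ⊣ G)
  [G.Additive] [PreservesFiniteLimits G] [PreservesFiniteColimits G]
  {T : C ⥤ C} [T.Additive] [PreservesFiniteLimits T] [PreservesFiniteColimits T]

/-- Let `w : T ∘ G → G` be a natural transformation. An endomorphism `τ` of `F X` whose adjoint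
factors through `w` acts on `Ext(F X, Y) ≅ Ext(X, G Y)` through the functor `T` and `w`.
This is the formula for the action on classes which come from a class in `Ext(X, Z)` and a morphism
`j : Z ⟶ G Y`. -/
theorem extAdj_mk₀_comp_of_square {w : G ⋙ T ⟶ G} {X : C} {α : X ⟶ T.obj X}
    {τ : F.obj X ⟶ F.obj X}
    (hτ : adj.unit.app X ≫ G.map τ = α ≫ T.map (adj.unit.app X) ≫ w.app (F.obj X))
    {Y : D} {Z : C} {j j' : Z ⟶ G.obj Y} {β : T.obj Z ⟶ Z}
    (hj : T.map j ≫ w.app Y = β ≫ j') {i : ℕ} {x : Ext (F.obj X) Y i} {d : Ext X Z i}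
    (hx : extAdj adj X Y i x = d.comp (Ext.mk₀ j) (add_zero i)) :
    extAdj adj X Y i ((Ext.mk₀ τ).comp x (zero_add i)) =
      (((Ext.mk₀ α).comp (d.mapExactFunctor T) (zero_add i)).comp
        (Ext.mk₀ β) (add_zero i)).comp (Ext.mk₀ j') (add_zero i) := by
  have hx' := congrArg (Ext.mapExactFunctor T) hx
  rw [extAdj_apply, Ext.mapExactFunctor_comp, Ext.mapExactFunctor_comp, Ext.mapExactFunctor_mk₀,
    Ext.mapExactFunctor_mk₀, ← mapExactFunctor_compFunctor] at hx'
  rw [extAdj_apply, Ext.mapExactFunctor_comp, Ext.mapExactFunctor_mk₀, Ext.mk₀_comp_mk₀_assoc, hτ,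
    Ext.comp_assoc_of_third_deg_zero, Ext.comp_assoc_of_third_deg_zero,
    Ext.mk₀_comp_mk₀, ← hj, ← Ext.mk₀_comp_mk₀ (T.map j),
    ← Ext.comp_assoc_of_third_deg_zero (d.mapExactFunctor T), ← hx',
    Ext.comp_assoc_of_third_deg_zero, ← mapExactFunctor_naturality w x,
    Ext.mk₀_comp_mk₀_assoc, Ext.mk₀_comp_mk₀_assoc, Category.assoc]

end TwistedAdjunction

/-! ### Finite resolutions by finitely generated projective modules -/

section FiniteResolutions

variable {R : Type u} [Ring R]

/-- `M` has a resolution of length at most `m` by finitely generated projective modules.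
The definition is by recursion on the length: the kernel of the augmentation has a resolution of
length at most `m - 1`. -/
def HasFiniteResolution (R : Type u) [Ring R] :
    ℕ → ∀ (M : Type v) [AddCommGroup M] [Module R M], Prop
  | 0, M, _, _ => Module.Finite R M ∧ Module.Projective R M
  | m + 1, M, _, _ => ∃ (P : Type v) (_ : AddCommGroup P) (_ : Module R P) (p : P →ₗ[R] M),
      Module.Finite R P ∧ Module.Projective R P ∧ Function.Surjective p ∧
        HasFiniteResolution R m (LinearMap.ker p)

section

variable {M N K L P Q X Y Z : Type v} [AddCommGroup M] [Module R M] [AddCommGroup N] [Module R N]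
  [AddCommGroup K] [Module R K] [AddCommGroup L] [Module R L] [AddCommGroup P] [Module R P]
  [AddCommGroup Q] [Module R Q] [AddCommGroup X] [Module R X] [AddCommGroup Y] [Module R Y]
  [AddCommGroup Z] [Module R Z]

theorem exists_equiv_prod_of_exact [Module.Projective R Q] {f : K →ₗ[R] L} {g : L →ₗ[R] Q}
    (hf : Function.Injective f) (hg : Function.Surjective g) (h : Function.Exact f g) :
    Nonempty (L ≃ₗ[R] K × Q) := by
  obtain ⟨l, hl⟩ := Module.projective_lifting_property g LinearMap.id hg
  exact ⟨(h.splitSurjectiveEquiv hf ⟨l, hl⟩).1⟩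

theorem HasFiniteResolution.of_equiv {m : ℕ} (h : HasFiniteResolution R m M) (e : M ≃ₗ[R] N) :
    HasFiniteResolution R m N := by
  cases m with
  | zero =>
    obtain ⟨h₁, h₂⟩ := h
    exact ⟨Module.Finite.equiv e, Module.Projective.of_equiv e⟩
  | succ m =>
    obtain ⟨P, _, _, p, h₁, h₂, h₃, h₄⟩ := h
    refine ⟨P, _, _, e.toLinearMap ∘ₗ p, h₁, h₂, e.surjective.comp h₃, ?_⟩
    rwa [LinearEquiv.ker_comp]

theorem HasFiniteResolution.of_exact {m : ℕ} [Module.Finite R P] [Module.Projective R P]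
    {i : K →ₗ[R] P} {p : P →ₗ[R] M} (hi : Function.Injective i) (hp : Function.Surjective p)
    (h : Function.Exact i p) (hK : HasFiniteResolution R m K) :
    HasFiniteResolution R (m + 1) M :=
  ⟨P, _, _, p, inferInstance, inferInstance, hp,
    hK.of_equiv ((LinearEquiv.ofInjective i hi).trans
      (LinearEquiv.ofEq _ _ h.linearMap_ker_eq.symm))⟩

theorem HasFiniteResolution.succ {m : ℕ} (h : HasFiniteResolution R m M) :
    HasFiniteResolution R (m + 1) M := by
  induction m generalizing M with
  | zero =>
    obtain ⟨h₁, h₂⟩ := h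
    refine HasFiniteResolution.of_exact (K := PUnit) (P := M) (i := 0) (p := LinearMap.id)
      (fun _ _ _ => rfl) Function.surjective_id (fun x => ?_) ⟨inferInstance, inferInstance⟩
    simp [eq_comm]
  | succ m ih =>
    obtain ⟨P, _, _, p, h₁, h₂, h₃, h₄⟩ := h
    exact ⟨P, _, _, p, h₁, h₂, h₃, ih h₄⟩

theorem HasFiniteResolution.finite {m : ℕ} (h : HasFiniteResolution R m M) :
    Module.Finite R M := by
  cases m with
  | zero => exact h.1
  | succ m =>
    obtain ⟨P, _, _, p, h₁, h₂, h₃, h₄⟩ := h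
    exact Module.Finite.of_surjective p h₃

theorem HasFiniteResolution.prod {m : ℕ} (h : HasFiniteResolution R m M) [Module.Finite R Q]
    [Module.Projective R Q] : HasFiniteResolution R m (M × Q) := by
  cases m with
  | zero =>
    obtain ⟨h₁, h₂⟩ := h
    exact ⟨inferInstance, inferInstance⟩
  | succ m =>
    obtain ⟨P, _, _, p, h₁, h₂, h₃, h₄⟩ := h
    refine HasFiniteResolution.of_exact (P := P × Q)
      (i := LinearMap.inl R P Q ∘ₗ (LinearMap.ker p).subtype) (p := p.prodMap LinearMap.id)
      (LinearMap.inl_injective.comp Subtype.val_injective)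
      (Function.Surjective.prodMap h₃ Function.surjective_id) ?_ h₄
    rintro ⟨x, y⟩
    simp only [LinearMap.prodMap_apply, LinearMap.id_apply, Prod.mk_eq_zero, Set.mem_range,
      LinearMap.comp_apply, Submodule.subtype_apply, LinearMap.inl_apply, Prod.mk.injEq,
      Subtype.exists, LinearMap.mem_ker]
    exact ⟨fun ⟨hx, hy⟩ => ⟨x, hx, rfl, hy.symm⟩, fun ⟨a, ha, e, hy⟩ => ⟨e ▸ ha, hy.symm⟩⟩

/-- Schanuel's lemma: the kernels of two surjections onto `M` from projective modules are stably
isomorphic. -/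
theorem schanuel [Module.Projective R P] [Module.Projective R Q] (p : P →ₗ[R] M) (q : Q →ₗ[R] M)
    (hp : Function.Surjective p) (hq : Function.Surjective q) :
    Nonempty ((LinearMap.ker p × Q) ≃ₗ[R] (LinearMap.ker q × P)) := by
  let W := LinearMap.ker ((p ∘ₗ LinearMap.fst R P Q) - (q ∘ₗ LinearMap.snd R P Q))
  have hW : ∀ x : P × Q, x ∈ W ↔ p x.1 = q x.2 := fun x => by
    simp [W, LinearMap.mem_ker, sub_eq_zero]
  let i : LinearMap.ker p →ₗ[R] W :=
    (LinearMap.inl R P Q ∘ₗ (LinearMap.ker p).subtype).codRestrict W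
      (fun x => by rw [hW]; simp)
  let j : LinearMap.ker q →ₗ[R] W :=
    (LinearMap.inr R P Q ∘ₗ (LinearMap.ker q).subtype).codRestrict W
      (fun x => by rw [hW]; simp)
  obtain ⟨e⟩ := exists_equiv_prod_of_exact (f := i) (g := LinearMap.snd R P Q ∘ₗ W.subtype)
    (fun x y h => Subtype.ext (congrArg (fun w : W => w.1.1) h))
    (fun y => by
      obtain ⟨x, hx⟩ := hp (q y)
      exact ⟨⟨(x, y), (hW _).2 hx⟩, rfl⟩)
    (fun ⟨⟨x, y⟩, h⟩ => by
      constructor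
      · intro (hy : y = 0)
        subst hy
        exact ⟨⟨x, by simpa using (hW _).1 h⟩, rfl⟩
      · rintro ⟨z, hz⟩
        exact (congrArg (fun w : W => w.1.2) hz).symm)
  obtain ⟨e'⟩ := exists_equiv_prod_of_exact (f := j) (g := LinearMap.fst R P Q ∘ₗ W.subtype)
    (fun x y h => Subtype.ext (congrArg (fun w : W => w.1.2) h))
    (fun x => by
      obtain ⟨y, hy⟩ := hq (p x)
      exact ⟨⟨(x, y), (hW _).2 hy.symm⟩, rfl⟩)
    (fun ⟨⟨x, y⟩, h⟩ => by
      constructor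
      · intro (hx : x = 0)
        subst hx
        exact ⟨⟨y, by simpa using ((hW _).1 h).symm⟩, rfl⟩
      · rintro ⟨z, hz⟩
        exact (congrArg (fun w : W => w.1.1) hz).symm)
  exact ⟨e.symm.trans e'⟩

/-- By Schanuel's lemma, the augmentation of a finite resolution may be replaced by any other
surjection `q` from a finitely generated projective module. The assumption `hm` on direct summands
of smaller length is provided by the induction in `HasFiniteResolution.fst`. -/
theorem HasFiniteResolution.ker_of_fst {m : ℕ}
    (hm : ∀ (M N : Type v) [AddCommGroup M] [Module R M] [AddCommGroup N] [Module R N],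
      HasFiniteResolution R m (M × N) → HasFiniteResolution R m M)
    (h : HasFiniteResolution R (m + 1) M) [Module.Finite R Q] [Module.Projective R Q]
    (q : Q →ₗ[R] M) (hq : Function.Surjective q) :
    HasFiniteResolution R m (LinearMap.ker q) := by
  obtain ⟨P, _, _, p, h₁, h₂, h₃, h₄⟩ := h
  obtain ⟨e⟩ := schanuel p q h₃ hq
  exact hm _ _ (h₄.prod.of_equiv e)

/-- A direct summand of a module with a finite resolution has a finite resolution. -/
theorem HasFiniteResolution.fst {m : ℕ} (h : HasFiniteResolution R m (M × N)) :
    HasFiniteResolution R m M := by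
  induction m generalizing M N with
  | zero =>
    obtain ⟨h₁, h₂⟩ := h
    exact ⟨Module.Finite.of_surjective (LinearMap.fst R M N) LinearMap.fst_surjective,
      Module.Projective.of_split (LinearMap.inl R M N) (LinearMap.fst R M N) (by ext; rfl)⟩
  | succ m ih =>
    obtain ⟨P, _, _, p, h₁, h₂, h₃, h₄⟩ := id h
    -- `P` maps onto both factors, and the kernels are the factors of the kernel of `P × P → M × N`
    let f := LinearMap.fst R M N ∘ₗ p
    let g := LinearMap.snd R M N ∘ₗ p
    have hf : Function.Surjective f := Prod.fst_surjective.comp h₃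
    have hg : Function.Surjective g := Prod.snd_surjective.comp h₃
    have hk := HasFiniteResolution.ker_of_fst (fun _ _ _ _ _ _ h => ih h) h (f.prodMap g)
      (Function.Surjective.prodMap hf hg)
    let e : LinearMap.ker (f.prodMap g) ≃ₗ[R] (LinearMap.ker f × LinearMap.ker g) :=
      { toFun := fun x => (⟨x.1.1, congrArg Prod.fst x.2⟩, ⟨x.1.2, congrArg Prod.snd x.2⟩)
        invFun := fun x => ⟨(x.1.1, x.2.1), Prod.ext x.1.2 x.2.2⟩
        map_add' := fun _ _ => rfl
        map_smul' := fun _ _ => rfl }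
    exact ⟨P, _, _, f, h₁, h₂, hf, ih (hk.of_equiv e)⟩

theorem HasFiniteResolution.of_retract {m : ℕ} (h : HasFiniteResolution R m N) (i : M →ₗ[R] N)
    (r : N →ₗ[R] M) (hr : r ∘ₗ i = LinearMap.id) : HasFiniteResolution R m M := by
  have hri : ∀ x, r (i x) = x := fun x => LinearMap.congr_fun hr x
  have hex : Function.Exact (LinearMap.ker r).subtype r := fun x => by simp
  exact HasFiniteResolution.fst (N := LinearMap.ker r) (h.of_equiv
    ((hex.splitSurjectiveEquiv Subtype.val_injective ⟨i, hr⟩).1.trans (LinearEquiv.prodComm R _ _)))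

/-- The horseshoe lemma: extensions of modules with finite resolutions have finite resolutions. -/
theorem HasFiniteResolution.of_extension {m : ℕ} {f : K →ₗ[R] L} {g : L →ₗ[R] X}
    (hf : Function.Injective f) (hg : Function.Surjective g) (h : Function.Exact f g)
    (hK : HasFiniteResolution R m K) (hX : HasFiniteResolution R m X) :
    HasFiniteResolution R m L := by
  induction m generalizing K L X with
  | zero =>
    obtain ⟨h₁, h₂⟩ := hX
    obtain ⟨e⟩ := exists_equiv_prod_of_exact hf hg h
    exact hK.prod.of_equiv e.symm
  | succ m ih =>
    obtain ⟨P, _, _, p, h₁, h₂, h₃, h₄⟩ := hK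
    obtain ⟨Q, _, _, q, k₁, k₂, k₃, k₄⟩ := hX
    obtain ⟨q', hq'⟩ := Module.projective_lifting_property g q hg
    have hq'' : ∀ x, g (q' x) = q x := fun x => LinearMap.congr_fun hq' x
    have hgf : ∀ x, g (f x) = 0 := fun x => h.apply_apply_eq_zero x
    -- `P × Q → L` is surjective, and its kernel is an extension of `ker q` by `ker p`
    let r := (f ∘ₗ p).coprod q'
    have hr : Function.Surjective r := by
      intro y
      obtain ⟨b, hb⟩ := k₃ (g y)
      obtain ⟨x, hx⟩ := (h (y - q' b)).1 (by rw [map_sub, hq'', hb, sub_self])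
      obtain ⟨a, rfl⟩ := h₃ x
      exact ⟨(a, b), by simp [r, hx]⟩
    refine ⟨P × Q, _, _, r, inferInstance, inferInstance, hr, ?_⟩
    let i : LinearMap.ker p →ₗ[R] LinearMap.ker r :=
      (LinearMap.inl R P Q ∘ₗ (LinearMap.ker p).subtype).codRestrict _
        (fun x => by simp [r])
    have hker : ∀ x : LinearMap.ker r, q x.1.2 = 0 := by
      rintro ⟨⟨a, b⟩, hx⟩
      have := congrArg g (LinearMap.mem_ker.1 hx)
      simpa [r, hgf, hq''] using this
    let j : LinearMap.ker r →ₗ[R] LinearMap.ker q :=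
      (LinearMap.snd R P Q ∘ₗ (LinearMap.ker r).subtype).codRestrict _ (fun x => hker x)
    refine ih (f := i) (g := j)
      (fun x y h => Subtype.ext (congrArg (fun w : LinearMap.ker r => w.1.1) h)) ?_ ?_ h₄ k₄
    · rintro ⟨b, hb⟩
      obtain ⟨x, hx⟩ := (h (q' b)).1 (by rw [hq'']; exact hb)
      obtain ⟨a, rfl⟩ := h₃ x
      exact ⟨⟨(-a, b), by simp [r, hx]⟩, rfl⟩
    · rintro ⟨⟨a, b⟩, hx⟩
      constructor
      · intro hb
        have hb : b = 0 := congrArg Subtype.val hb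
        subst hb
        refine ⟨⟨a, ?_⟩, rfl⟩
        rw [LinearMap.mem_ker] at hx ⊢
        apply hf
        simpa [r] using hx
      · rintro ⟨z, hz⟩
        exact Subtype.ext (congrArg (fun w : LinearMap.ker r => w.1.2) hz).symm

/-- If `X` and `Y` have finite resolutions, then so does the cokernel `Z` of an injective map
`X → Y`. -/
theorem HasFiniteResolution.of_cokernel {m : ℕ} {f : X →ₗ[R] Y} {g : Y →ₗ[R] Z}
    (hf : Function.Injective f) (hg : Function.Surjective g) (h : Function.Exact f g)
    (hX : HasFiniteResolution R m X) (hY : HasFiniteResolution R m Y) :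
    HasFiniteResolution R (m + 1) Z := by
  obtain ⟨P, _, _, p, h₁, h₂, h₃, h₄⟩ := hY.succ
  refine ⟨P, _, _, g ∘ₗ p, h₁, h₂, hg.comp h₃, ?_⟩
  -- the kernel of `P → Z` is an extension of `ker g ≅ X` by `ker p`
  let i : LinearMap.ker p →ₗ[R] LinearMap.ker (g ∘ₗ p) :=
    Submodule.inclusion (LinearMap.ker_le_ker_comp p g)
  let j : LinearMap.ker (g ∘ₗ p) →ₗ[R] LinearMap.ker g :=
    (p ∘ₗ (LinearMap.ker (g ∘ₗ p)).subtype).codRestrict _ (fun x => x.2)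
  refine HasFiniteResolution.of_extension (f := i) (g := j) (Submodule.inclusion_injective _)
    ?_ ?_ h₄ (hX.of_equiv ((LinearEquiv.ofInjective f hf).trans
      (LinearEquiv.ofEq _ _ h.linearMap_ker_eq.symm)))
  · rintro ⟨y, hy⟩
    obtain ⟨x, rfl⟩ := h₃ y
    exact ⟨⟨x, hy⟩, rfl⟩
  · rintro ⟨x, hx⟩
    constructor
    · intro h
      exact ⟨⟨x, congrArg Subtype.val h⟩, rfl⟩
    · rintro ⟨⟨z, hz⟩, hz'⟩
      obtain rfl : z = x := congrArg Subtype.val hz'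
      exact Subtype.ext hz

end

end FiniteResolutions

section FiniteResolutions

section Splice

open Limits

variable {C : Type*} [Category* C] [Abelian C]

/-- A chain complex of projective objects which is exact in positive degrees, and whose cokernel in
degree `0` is `X`, is a projective resolution of `X`. -/
def resolutionOfExact {X : C} (K : ChainComplex C ℕ) (hK : ∀ i, Projective (K.X i))
    (p : K.X 0 ⟶ X) (hp : Epi p) (w : K.d 1 0 ≫ p = 0) (h₀ : (ShortComplex.mk _ _ w).Exact)
    (h : ∀ i, K.ExactAt (i + 1)) : ProjectiveResolution X where
  complex := K
  projective := hK
  π := (ChainComplex.toSingle₀Equiv _ _).symm ⟨p, w⟩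
  quasiIso := ⟨fun n => by
    cases n with
    | zero =>
      rw [ChainComplex.quasiIsoAt₀_iff, ShortComplex.quasiIso_iff_of_zeros']
      · refine (ShortComplex.exact_and_epi_g_iff_of_iso ?_).2 ⟨h₀, hp⟩
        refine ShortComplex.isoMk (Iso.refl _) (Iso.refl _) (Iso.refl _) ?_ ?_
        · exact (Category.id_comp _).trans (Category.comp_id _).symm
        · refine (Category.id_comp _).trans (Eq.trans ?_ (Category.comp_id _).symm)
          exact (ChainComplex.toSingle₀Equiv_symm_apply_f_zero p w).symm
      all_goals first | rfl | exact K.shape _ _ (by simp)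
    | succ n =>
      rw [quasiIsoAt_iff_exactAt']
      · exact h n
      · apply ChainComplex.exactAt_succ_single_obj⟩

/-- Splicing a short exact sequence `0 → X₁ → X₂ → X₃ → 0` with `X₂` projective with a projective
resolution of `X₁`. -/
def spliceResolution {S : ShortComplex C}
    (hS : S.ShortExact) (hP : Projective S.X₂) (P : ProjectiveResolution S.X₁) :
    ProjectiveResolution S.X₃ :=
  have hepi := hS.epi_g
  have hmono := hS.mono_f
  let p : P.complex.X 0 ⟶ S.X₁ := P.π.f 0
  have hp : Epi p := inferInstanceAs (Epi (P.π.f 0))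
  have w : P.complex.d 1 0 ≫ p = 0 := P.complex_d_comp_π_f_zero
  have w' : P.complex.d 1 0 ≫ p ≫ S.f = 0 := by rw [← Category.assoc, w, zero_comp]
  have w'' : (p ≫ S.f) ≫ S.g = 0 := by rw [Category.assoc, S.zero, comp_zero]
  resolutionOfExact (P.complex.augment (p ≫ S.f) w')
    (fun | 0 => hP
         | i + 1 => P.projective i)
    S.g hepi w''
    (by
      let α : ShortComplex.mk (p ≫ S.f) S.g w'' ⟶ S := { τ₁ := p, τ₂ := 𝟙 _, τ₃ := 𝟙 _ }
      have : Epi α.τ₁ := hp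
      have : IsIso α.τ₂ := inferInstanceAs (IsIso (𝟙 _))
      have : Mono α.τ₃ := inferInstanceAs (Mono (𝟙 _))
      exact (ShortComplex.exact_iff_of_epi_of_isIso_of_mono α).2 hS.exact)
    (fun i => by
      rcases i with _ | i
      · rw [HomologicalComplex.exactAt_iff' _ 2 1 0 (by simp) (by simp)]
        let α : ShortComplex.mk (P.complex.d 1 0) p w ⟶ ShortComplex.mk _ _ w' :=
          { τ₁ := 𝟙 _, τ₂ := 𝟙 _, τ₃ := S.f }
        have : Epi α.τ₁ := inferInstanceAs (Epi (𝟙 _))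
        have : IsIso α.τ₂ := inferInstanceAs (IsIso (𝟙 _))
        have : Mono α.τ₃ := hmono
        exact (ShortComplex.exact_iff_of_epi_of_isIso_of_mono α).1 P.exact₀
      · rw [HomologicalComplex.exactAt_iff' _ (i + 3) (i + 2) (i + 1) (by simp) (by simp)]
        exact P.exact_succ i)

end Splice

variable {R : Type v} [Ring R]

theorem HasFiniteResolution.exists_projectiveResolution {M : ModuleCat.{v} R} {m : ℕ}
    (h : HasFiniteResolution R m M) :
    ∃ P : ProjectiveResolution M, (∀ i, Module.Finite R (P.complex.X i)) ∧
      ∀ i, m < i → Limits.IsZero (P.complex.X i) := by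
  induction m generalizing M with
  | zero =>
    obtain ⟨h₁, h₂⟩ := h
    have : Projective M := (IsProjective.iff_projective M).1 h₂
    have hz : ∀ i, 0 < i → Limits.IsZero ((ProjectiveResolution.self M).complex.X i) :=
      fun i hi => HomologicalComplex.isZero_single_obj_X _ _ _ _ hi.ne'
    refine ⟨ProjectiveResolution.self M, fun i => ?_, hz⟩
    rcases i with _ | i
    · exact h₁
    · have := ModuleCat.subsingleton_of_isZero (hz (i + 1) (by simp))
      infer_instance
  | succ m ih =>
    obtain ⟨P, _, _, p, h₁, h₂, h₃, h₄⟩ := h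
    obtain ⟨Q, hQ, hQ'⟩ := ih (M := ModuleCat.of R (LinearMap.ker p)) h₄
    refine ⟨spliceResolution (LinearMap.shortExact_shortComplexKer h₃)
      ((IsProjective.iff_projective P).1 h₂) Q, fun i => ?_, fun i hi => ?_⟩
    · rcases i with _ | i
      · exact h₁
      · exact hQ i
    · rcases i with _ | i
      · omega
      · exact hQ' i (by omega)

/-- The bound `m + 1` comes from starting the induction with the image of the differential from
degree `m + 1` to degree `m`, which vanishes. -/
theorem exists_hasFiniteResolution {M : ModuleCat.{v} R} (P : ProjectiveResolution M) {m : ℕ}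
    (hfin : ∀ i, Module.Finite R (P.complex.X i))
    (hzero : ∀ i, m < i → Limits.IsZero (P.complex.X i)) :
    HasFiniteResolution R (m + 1) M := by
  have hproj : ∀ i, Module.Projective R (P.complex.X i) := fun i =>
    (IsProjective.iff_projective _).2 (P.projective i)
  have key : ∀ j i, i + j = m → HasFiniteResolution R j
      (LinearMap.range (P.complex.d (i + 1) i).hom) := by
    intro j
    induction j with
    | zero =>
      rintro i rfl
      have := ModuleCat.subsingleton_of_isZero (hzero (i + 1) (by simp))
      have h := (LinearMap.surjective_rangeRestrict (P.complex.d (i + 1) i).hom).subsingleton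
      exact ⟨inferInstance, inferInstance⟩
    | succ j ih =>
      intro i hi
      refine ⟨P.complex.X (i + 1), _, _, (P.complex.d (i + 1) i).hom.rangeRestrict, hfin _,
        hproj _, LinearMap.surjective_rangeRestrict _, ?_⟩
      rw [LinearMap.ker_rangeRestrict]
      have := (P.exact_succ i).moduleCat_range_eq_ker
      exact (ih (i + 1) (by omega)).of_equiv (LinearEquiv.ofEq _ _ this)
  let p : P.complex.X 0 ⟶ M := P.π.f 0
  have hp : Epi p := inferInstanceAs (Epi (P.π.f 0))
  refine ⟨P.complex.X 0, _, _, p.hom, hfin _, hproj _, (ModuleCat.epi_iff_surjective p).1 hp, ?_⟩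
  exact (key m 0 (by simp)).of_equiv (LinearEquiv.ofEq _ _ P.exact₀.moduleCat_range_eq_ker)

section Free

open Abelian

/-- If `M` has a finite resolution by finitely generated projective modules, then `Ext^i(M, -)`
commutes with direct sums; in particular, `Ext^i(M, N)` for a free module `N` is generated by
the images of `Ext^i(M, R)` under the linear maps `R → N`. -/
theorem ext_free_mem_closure {ι : Type*} (N : ModuleCat.{v} R) (b : Module.Basis ι R N) {m : ℕ}
    {M : ModuleCat.{v} R} (hM : HasFiniteResolution R m M) {i : ℕ} (x : Ext M N i) :
    x ∈ AddSubgroup.closure {y : Ext M N i | ∃ (d : Ext M (ModuleCat.of R R) i)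
      (f : ModuleCat.of R R ⟶ N), d.comp (Ext.mk₀ f) (add_zero i) = y} := by
  induction i generalizing M m with
  | zero =>
    obtain ⟨f, rfl⟩ := (Ext.mk₀_bijective _ _).2 x
    -- a map from a finitely generated module involves only finitely many coordinates
    obtain ⟨s, hs⟩ := hM.finite.fg_top
    classical
    let t : Finset ι := s.biUnion fun y => (b.repr (f y)).support
    let g : ι → (M ⟶ N) := fun j =>
      ModuleCat.ofHom (b.coord j ∘ₗ f.hom) ≫
        ModuleCat.ofHom (LinearMap.toSpanSingleton R N (b j))
    have hf : f = ∑ j ∈ t, g j := by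
      apply ModuleCat.hom_ext
      apply LinearMap.ext_on hs
      intro y hy
      simp only [ModuleCat.hom_sum, LinearMap.sum_apply, g, ModuleCat.hom_comp, ModuleCat.hom_ofHom,
        LinearMap.comp_apply, LinearMap.toSpanSingleton_apply, Module.Basis.coord_apply]
      conv_lhs => rw [← b.linearCombination_repr (f y)]
      rw [Finsupp.linearCombination_apply]
      exact Finsupp.sum_of_support_subset _
        (fun j hj => Finset.mem_biUnion.2 ⟨y, hy, hj⟩) _ (by simp)
    have : Ext.mk₀ f = ∑ j ∈ t, Ext.mk₀ (g j) := by
      rw [hf]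
      exact map_sum Ext.addEquiv₀.symm _ _
    rw [this]
    refine AddSubgroup.sum_mem _ fun j _ => AddSubgroup.subset_closure ?_
    exact ⟨Ext.mk₀ _, _, Ext.mk₀_comp_mk₀ _ _⟩
  | succ i ih =>
    obtain ⟨P, _, _, p, h₁, h₂, h₃, h₄⟩ := hM.succ
    have hS := LinearMap.shortExact_shortComplexKer h₃
    have hP : Projective (ModuleCat.of R P) := (IsProjective.iff_projective P).1 h₂
    obtain ⟨y, rfl⟩ := exists_eq_extClass_comp hS x
    have := ih (M := ModuleCat.of R (LinearMap.ker p)) h₄ y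
    induction this using AddSubgroup.closure_induction with
    | mem y hy =>
      obtain ⟨d, f, rfl⟩ := hy
      refine AddSubgroup.subset_closure ⟨hS.extClass.comp d (Nat.add_comm 1 i), f, ?_⟩
      exact Ext.comp_assoc_of_third_deg_zero _ _ _ _
    | zero => rw [Ext.comp_zero]; exact zero_mem _
    | add y z _ _ hy hz => rw [Ext.comp_add]; exact add_mem hy hz
    | neg y _ hy => rw [Ext.comp_neg]; exact neg_mem hy

end Free

end FiniteResolutions

/-! ### Induction along a free ring extension -/

section Induction

variable {R S I : Type v} [Ring R] [Ring S] {φ : R →+* S}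

/-- A basis of `S` as a right module over `R`, where `R` acts through the ring homomorphism `φ`:
every element of `S` is uniquely a finite sum `∑ i, vec i * φ (r i)`. -/
structure RightBasis (φ : R →+* S) (I : Type v) where
  /-- The basis vectors. -/
  vec : I → S
  /-- The coordinates with respect to the basis. -/
  repr : S ≃+ (I →₀ R)
  repr_vec_mul : ∀ i r, repr (vec i * φ r) = Finsupp.single i r

namespace RightBasis

variable (b : RightBasis φ I)

theorem induction {p : S → Prop} (zero : p 0) (add : ∀ s t, p s → p t → p (s + t))
    (vec_mul : ∀ i r, p (b.vec i * φ r)) (s : S) : p s := by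
  obtain ⟨c, rfl⟩ := b.repr.symm.surjective s
  induction c using Finsupp.induction_linear with
  | zero => simpa using zero
  | add f g hf hg => rw [map_add]; exact add _ _ hf hg
  | single i r =>
    rw [← b.repr_vec_mul, AddEquiv.symm_apply_apply]
    exact vec_mul i r

/-- The `S`-module induced from an `R`-module `M`, that is, `S ⊗_R M`. Since `S` is free over `R`
on the right, it is modelled on the direct sum of copies of `M` indexed by a basis; the element
`x` of the summand with index `i` is `vec i ⊗ x`. -/
def Induced (_ : RightBasis φ I) (M : Type v) [AddCommGroup M] [Module R M] : Type v := I →₀ M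

section Module

variable (M : Type v) [AddCommGroup M] [Module R M]

instance : AddCommGroup (b.Induced M) := inferInstanceAs (AddCommGroup (I →₀ M))

variable {M}

/-- The inclusion of the summand with index `i`. -/
def incl (i : I) : M →+ b.Induced M := Finsupp.singleAddHom i

theorem induced_hom_ext {N : Type*} [AddCommGroup N] {f g : b.Induced M →+ N}
    (h : ∀ i x, f (b.incl i x) = g (b.incl i x)) : f = g :=
  Finsupp.addHom_ext h

/-- The pure tensor `s ⊗ x` in the induced module `S ⊗_R M`. -/
def tmul : S →+ M →+ b.Induced M :=
  (Finsupp.liftAddHom fun i => (AddMonoidHom.compHom (b.incl i)).comp (smulAddHom R M)).comp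
    b.repr.toAddMonoidHom

theorem tmul_vec_mul (i : I) (r : R) (x : M) :
    b.tmul (b.vec i * φ r) x = b.incl i (r • x) := by
  simp [tmul, b.repr_vec_mul]

theorem tmul_vec (i : I) (x : M) : b.tmul (b.vec i) x = b.incl i x := by
  simpa using b.tmul_vec_mul i 1 x

theorem tmul_mul (s : S) (r : R) (x : M) : b.tmul (s * φ r) x = b.tmul s (r • x) := by
  induction s using b.induction with
  | zero => simp
  | add s t hs ht => simp [add_mul, hs, ht]
  | vec_mul i r' => rw [mul_assoc, ← map_mul, tmul_vec_mul, tmul_vec_mul, mul_smul]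

/-- The additive map out of an induced module which is given by `f i` on the summand with
index `i`. -/
def ofSummands {N : Type*} [AddCommGroup N] (f : I → M →+ N) : b.Induced M →+ N :=
  Finsupp.liftAddHom f

@[simp]
theorem ofSummands_incl {N : Type*} [AddCommGroup N] (f : I → M →+ N) (i : I) (x : M) :
    b.ofSummands f (b.incl i x) = f i x :=
  Finsupp.liftAddHom_apply_single f i x

/-- Left multiplication by elements of `S` on the induced module. -/
def act : S →+ b.Induced M →+ b.Induced M where
  toFun s := b.ofSummands fun j => b.tmul (s * b.vec j)
  map_zero' := b.induced_hom_ext fun i x => by simp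
  map_add' s t := b.induced_hom_ext fun i x => by simp [add_mul]

theorem act_incl (s : S) (i : I) (x : M) : b.act s (b.incl i x) = b.tmul (s * b.vec i) x :=
  b.ofSummands_incl _ i x

theorem act_tmul (s t : S) (x : M) : b.act s (b.tmul t x) = b.tmul (s * t) x := by
  induction t using b.induction with
  | zero => simp
  | add t t' h h' => simp [mul_add, h, h']
  | vec_mul i r => rw [tmul_vec_mul, act_incl, ← mul_assoc, tmul_mul]

instance : Module S (b.Induced M) where
  smul s m := b.act s m
  one_smul m := by
    have : b.act (1 : S) = AddMonoidHom.id (b.Induced M) := b.induced_hom_ext fun i x => by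
      rw [act_incl, one_mul, tmul_vec]; rfl
    exact DFunLike.congr_fun this m
  mul_smul s t m := by
    have : b.act (s * t) = (b.act s).comp (b.act (M := M) t) := b.induced_hom_ext fun i x => by
      rw [AddMonoidHom.comp_apply, act_incl, act_incl, act_tmul, mul_assoc]
    exact DFunLike.congr_fun this m
  smul_zero s := map_zero (b.act s)
  smul_add s := map_add (b.act s)
  add_smul s t m := by
    change b.act (s + t) m = b.act s m + b.act t m
    rw [map_add, AddMonoidHom.add_apply]
  zero_smul m := by
    change b.act 0 m = 0
    rw [map_zero, AddMonoidHom.zero_apply]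

theorem smul_tmul (s t : S) (x : M) : s • b.tmul t x = b.tmul (s * t) x := b.act_tmul s t x

theorem induced_induction {p : b.Induced M → Prop} (zero : p 0)
    (add : ∀ m n, p m → p n → p (m + n)) (tmul : ∀ s x, p (b.tmul s x)) (m : b.Induced M) :
    p m := by
  induction m using Finsupp.induction_linear with
  | zero => exact zero
  | add f g hf hg => exact add _ _ hf hg
  | single i x => have h := tmul (b.vec i) x; rw [tmul_vec] at h; exact h

section Lift

variable {N : Type*} [AddCommGroup N] [Module S N]

/-- The additive map underlying `lift`, evaluated on pure tensors. -/
theorem ofSummands_smul_tmul (f : M →+ N) (hf : ∀ r x, f (r • x) = φ r • f x) (s : S) (x : M) :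
    b.ofSummands (fun i => (DistribSMul.toAddMonoidHom N (b.vec i)).comp f) (b.tmul s x) =
      s • f x := by
  induction s using b.induction with
  | zero => simp
  | add s t hs ht => simp [hs, ht, add_smul]
  | vec_mul i r => simp [tmul_vec_mul, hf, mul_smul]

/-- The universal property of the induced module: an `R`-linear map from `M` to an `S`-module
extends uniquely to an `S`-linear map from `S ⊗_R M`. -/
def lift (f : M →+ N) (hf : ∀ r x, f (r • x) = φ r • f x) : b.Induced M →ₗ[S] N where
  toFun := b.ofSummands fun i => (DistribSMul.toAddMonoidHom N (b.vec i)).comp f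
  map_add' := map_add _
  map_smul' := fun s m => by
    induction m using b.induced_induction with
    | zero => simp
    | add m n hm hn => simp_all
    | tmul t x =>
      rw [smul_tmul, b.ofSummands_smul_tmul f hf, b.ofSummands_smul_tmul f hf, RingHom.id_apply,
        mul_smul]

theorem lift_tmul (f : M →+ N) (hf : ∀ r x, f (r • x) = φ r • f x) (s : S) (x : M) :
    b.lift f hf (b.tmul s x) = s • f x :=
  b.ofSummands_smul_tmul f hf s x

theorem induced_linear_ext {f g : b.Induced M →ₗ[S] N}
    (h : ∀ x, f (b.tmul 1 x) = g (b.tmul 1 x)) : f = g := by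
  ext m
  induction m using b.induced_induction with
  | zero => simp
  | add m n hm hn => simp [hm, hn]
  | tmul s x => rw [← mul_one s, ← smul_tmul, map_smul, map_smul, h]

end Lift

section Map

variable {N : Type v} [AddCommGroup N] [Module R N]

/-- The map `S ⊗_R M → S ⊗_R N` induced by an `R`-linear map `M → N`. -/
def map (f : M →ₗ[R] N) : b.Induced M →ₗ[S] b.Induced N :=
  b.lift ((b.tmul 1).comp f.toAddMonoidHom) (fun r x => by
    have h := b.tmul_mul 1 r (f x)
    rw [one_mul] at h
    simp [smul_tmul, h])

theorem map_tmul (f : M →ₗ[R] N) (s : S) (x : M) : b.map f (b.tmul s x) = b.tmul s (f x) := by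
  simp [map, lift_tmul, smul_tmul]

theorem map_incl (f : M →ₗ[R] N) (i : I) (x : M) : b.map f (b.incl i x) = b.incl i (f x) := by
  rw [← tmul_vec, map_tmul, tmul_vec]

theorem map_eq_mapRange (f : M →ₗ[R] N) (m : b.Induced M) :
    b.map f m = Finsupp.mapRange f (map_zero f) m := by
  have h : (b.map f).toAddMonoidHom = Finsupp.mapRange.addMonoidHom f.toAddMonoidHom :=
    b.induced_hom_ext fun i x => by
      refine (b.map_incl f i x).trans ?_
      exact (Finsupp.mapRange_single (hf := map_zero f)).symm
  exact DFunLike.congr_fun h m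

theorem map_injective {f : M →ₗ[R] N} (hf : Function.Injective f) :
    Function.Injective (b.map f) := by
  intro m n h
  rw [map_eq_mapRange, map_eq_mapRange] at h
  exact Finsupp.mapRange_injective f (map_zero f) hf h

theorem map_surjective {f : M →ₗ[R] N} (hf : Function.Surjective f) :
    Function.Surjective (b.map f) := by
  intro m
  obtain ⟨n, hn⟩ := Finsupp.mapRange_surjective f (map_zero f) hf m
  exact ⟨n, (b.map_eq_mapRange f n).trans hn⟩

theorem map_exact {L : Type v} [AddCommGroup L] [Module R L] {f : M →ₗ[R] N} {g : N →ₗ[R] L}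
    (h : Function.Exact f g) : Function.Exact (b.map f) (b.map g) := by
  intro n
  constructor
  · intro hn
    have hn' : ∀ i, g ((show I →₀ N from n) i) = 0 := fun i => by
      rw [map_eq_mapRange] at hn
      exact DFunLike.congr_fun (F := I →₀ L) hn i
    choose x hx using fun i => (h _).1 (hn' i)
    refine ⟨∑ i ∈ (show I →₀ N from n).support, b.incl i (x i), ?_⟩
    rw [map_sum]
    simp only [map_incl, hx]
    exact Finsupp.sum_single (show I →₀ N from n)
  · rintro ⟨m, rfl⟩
    rw [← LinearMap.comp_apply]
    have : b.map g ∘ₗ b.map f = 0 := b.induced_linear_ext fun x => by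
      simp [map_tmul, h.apply_apply_eq_zero]
    rw [this, LinearMap.zero_apply]

end Map

end Module

/-- Induction of modules along `φ : R →+* S`, as a functor. -/
def inductionFunctor : ModuleCat.{v} R ⥤ ModuleCat.{v} S where
  obj M := ModuleCat.of S (b.Induced M)
  map f := ModuleCat.ofHom (b.map f.hom)
  map_id M := by
    apply ModuleCat.hom_ext
    exact b.induced_linear_ext fun x => b.map_tmul _ _ _
  map_comp f g := by
    apply ModuleCat.hom_ext
    exact b.induced_linear_ext fun x => by
      simp [map_tmul]

/-- The map `x ↦ 1 ⊗ x` from `M` to `S ⊗_R M`. -/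
def inductionUnit (M : ModuleCat.{v} R) :
    M ⟶ (ModuleCat.restrictScalars.{v} φ).obj (b.inductionFunctor.obj M) :=
  ModuleCat.ofHom (Y := (ModuleCat.restrictScalars.{v} φ).obj (b.inductionFunctor.obj M))
    { toFun := fun x => b.tmul 1 x
      map_add' := map_add (b.tmul (M := M) 1)
      map_smul' := fun r x => by
        have h : b.tmul (φ r * 1) x = b.tmul 1 (r • x) := by
          rw [mul_one, ← b.tmul_mul, one_mul]
        exact h.symm.trans (b.smul_tmul _ _ _).symm }

/-- The map `s ⊗ x ↦ s • x` from `S ⊗_R N` to the `S`-module `N`. -/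
def inductionCounit (N : ModuleCat.{v} S) :
    b.inductionFunctor.obj ((ModuleCat.restrictScalars.{v} φ).obj N) ⟶ N :=
  ModuleCat.ofHom
    (b.lift (M := (ModuleCat.restrictScalars.{v} φ).obj N) (AddMonoidHom.id N) fun _ _ => rfl)

/-- Induction is left adjoint to restriction of scalars. -/
def inductionAdj : b.inductionFunctor ⊣ ModuleCat.restrictScalars.{v} φ where
  unit :=
    { app := b.inductionUnit
      naturality := fun M N f => by
        apply ModuleCat.hom_ext
        ext x
        exact (b.map_tmul f.hom 1 x).symm }
  counit :=
    { app := b.inductionCounit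
      naturality := fun M N f => by
        apply ModuleCat.hom_ext
        apply b.induced_linear_ext
        intro x
        have h1 := b.lift_tmul (M := (ModuleCat.restrictScalars.{v} φ).obj M)
          (AddMonoidHom.id M) (fun _ _ => rfl) 1 x
        have h2 := b.lift_tmul (M := (ModuleCat.restrictScalars.{v} φ).obj N)
          (AddMonoidHom.id N) (fun _ _ => rfl) 1 (f.hom x)
        have h3 := b.map_tmul ((ModuleCat.restrictScalars.{v} φ).map f).hom 1 x
        refine (congrArg (b.inductionCounit N).hom h3).trans (h2.trans ?_)
        refine Eq.trans ?_ (congrArg f.hom h1).symm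
        rw [one_smul, one_smul]
        rfl }
  left_triangle_components M := by
    apply ModuleCat.hom_ext
    apply b.induced_linear_ext
    intro x
    refine (congrArg (b.inductionCounit (b.inductionFunctor.obj M)).hom
      (b.map_tmul (b.inductionUnit M).hom 1 x)).trans ?_
    refine (b.lift_tmul (M := (ModuleCat.restrictScalars.{v} φ).obj (b.inductionFunctor.obj M))
      (AddMonoidHom.id _) (fun _ _ => rfl) 1 _).trans ?_
    exact one_smul S (b.tmul 1 x)
  right_triangle_components N := by
    apply ModuleCat.hom_ext
    ext x
    exact (b.lift_tmul (M := (ModuleCat.restrictScalars.{v} φ).obj N) (AddMonoidHom.id N)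
      (fun _ _ => rfl) 1 x).trans (one_smul S (x : N))

instance : b.inductionFunctor.Additive where
  map_add {M N f g} := by
    apply ModuleCat.hom_ext
    apply b.induced_linear_ext
    intro x
    change b.map (f.hom + g.hom) (b.tmul 1 x) =
      b.map f.hom (b.tmul 1 x) + b.map g.hom (b.tmul 1 x)
    simp [map_tmul]

theorem inductionFunctor_exact :
    Limits.PreservesFiniteLimits b.inductionFunctor ∧
      Limits.PreservesFiniteColimits b.inductionFunctor :=
  ((Functor.exact_tfae b.inductionFunctor).out 1 3).1 fun S hS => by
    rw [ShortComplex.ShortExact.moduleCat_exact_iff_function_exact] at hS ⊢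
    exact b.map_exact hS

instance : Limits.PreservesFiniteLimits b.inductionFunctor := b.inductionFunctor_exact.1

instance : Limits.PreservesFiniteColimits b.inductionFunctor := b.inductionFunctor_exact.2

/-- Induction is exact and preserves finitely generated projective modules. -/
theorem hasFiniteResolution_induced {m : ℕ} {M : Type v} [AddCommGroup M] [Module R M]
    (h : HasFiniteResolution R m M) : HasFiniteResolution S m (b.Induced M) := by
  have fgp : ∀ (P : Type v) [AddCommGroup P] [Module R P], Module.Finite R P →
      Module.Projective R P → Module.Finite S (b.Induced P) ∧ Module.Projective S (b.Induced P) := by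
    intro P _ _ h₁ h₂
    constructor
    · obtain ⟨s, hs⟩ := h₁.fg_top
      classical
      refine ⟨⟨s.image (b.tmul 1), ?_⟩⟩
      rw [eq_top_iff]
      rintro m -
      induction m using b.induced_induction with
      | zero => exact zero_mem _
      | add m n hm hn => exact add_mem hm hn
      | tmul t x =>
        have hx : x ∈ Submodule.span R (s : Set P) := hs ▸ Submodule.mem_top
        induction hx using Submodule.span_induction generalizing t with
        | zero => simp
        | add x y _ _ hx hy => rw [map_add]; exact add_mem (hx t) (hy t)
        | smul r x _ hx => rw [← tmul_mul]; exact hx _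
        | mem x hx =>
          rw [← mul_one t, ← smul_tmul]
          refine Submodule.smul_mem _ _ (Submodule.subset_span ?_)
          exact Finset.mem_coe.2 (Finset.mem_image_of_mem _ hx)
    · have : Projective (ModuleCat.of R P) := (IsProjective.iff_projective P).1 h₂
      exact (IsProjective.iff_projective (b.Induced P)).2
        (b.inductionAdj.map_projective (ModuleCat.of R P) this)
  induction m generalizing M with
  | zero => exact fgp M h.1 h.2
  | succ m ih =>
    obtain ⟨P, _, _, p, h₁, h₂, h₃, h₄⟩ := h
    obtain ⟨k₁, k₂⟩ := fgp P h₁ h₂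
    exact HasFiniteResolution.of_exact (b.map_injective (Submodule.subtype_injective _))
      (b.map_surjective h₃) (b.map_exact (LinearMap.exact_subtype_ker_map p)) (ih h₄)

end RightBasis
end Induction

/-! ### The smash product and its enveloping algebra -/

section SmashProduct

/-- The linear automorphism of a space of finitely supported functions which applies `e i` to the
value at `i`. -/
def finsuppCongr {k I M N : Type*} [Semiring k] [AddCommMonoid M] [AddCommMonoid N] [Module k M]
    [Module k N] (e : I → M ≃ₗ[k] N) : (I →₀ M) ≃ₗ[k] (I →₀ N) :=
  LinearEquiv.ofLinearMap (Finsupp.lsum ℕ fun i => Finsupp.lsingle i ∘ₗ (e i).toLinearMap)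
    (Finsupp.lsum ℕ fun i => Finsupp.lsingle i ∘ₗ (e i).symm.toLinearMap)
    (by ext; simp) (by ext; simp)

@[simp]
theorem finsuppCongr_single {k I M N : Type*} [Semiring k] [AddCommMonoid M] [AddCommMonoid N]
    [Module k M] [Module k N] (e : I → M ≃ₗ[k] N) (i : I) (x : M) :
    finsuppCongr e (Finsupp.single i x) = Finsupp.single i (e i x) := by
  simp [finsuppCongr]

variable {k : Type u} {A : Type v} [Field k] [Ring A] [Algebra k A] (G : Subgroup (A ≃ₐ[k] A))

/-- The inclusion of `A` into the smash product. -/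
def incl : A →ₐ[k] Smash G :=
  { SkewMonoidAlgebra.singleOneRingHom with
    commutes' := fun c => by
      rw [SkewMonoidAlgebra.coe_algebraMap]; rfl }

/-- The inclusion of the group `G` into the smash product. -/
def gen : G →* Smash G := SkewMonoidAlgebra.of A G

variable {G}

theorem incl_apply (a : A) : incl G a = SkewMonoidAlgebra.single 1 a := rfl

theorem gen_apply (g : G) : gen G g = SkewMonoidAlgebra.single g 1 := rfl

theorem incl_mul_gen (a : A) (g : G) : incl G a * gen G g = SkewMonoidAlgebra.single g a := by
  rw [incl_apply, gen_apply, SkewMonoidAlgebra.single_mul_single]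
  simp

theorem gen_mul_incl (g : G) (a : A) :
    gen G g * incl G a = incl G ((g : A ≃ₐ[k] A) a) * gen G g := by
  rw [incl_mul_gen, incl_apply, gen_apply, SkewMonoidAlgebra.single_mul_single]
  simp [Subgroup.smul_def]

theorem smash_induction {p : Smash G → Prop} (zero : p 0) (add : ∀ x y, p x → p y → p (x + y))
    (incl_mul_gen : ∀ a g, p (incl G a * gen G g)) (x : Smash G) : p x := by
  induction x using SkewMonoidAlgebra.induction_on with
  | zero => exact zero
  | single g a => rw [← CYSmash.incl_mul_gen]; exact incl_mul_gen a g
  | add x y hx hy => exact add _ _ hx hy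

variable (G)

/-- The coordinates on the smash product with respect to `G`, as a basis of the left
`A`-module `A ♯ kG`. -/
def leftCoord : Smash G ≃ₗ[k] (G →₀ A) := SkewMonoidAlgebra.coeffLinearEquiv (S := k)

/-- The coordinates on the smash product with respect to `G`, as a basis of the right
`A`-module `A ♯ kG`: since `a g = g g⁻¹(a)`, they are the left coordinates moved by `g⁻¹`. -/
def rightCoord : Smash G ≃ₗ[k] (G →₀ A) :=
  leftCoord G ≪≫ₗ finsuppCongr fun g => (g : A ≃ₐ[k] A).symm.toLinearEquiv

variable {G}

theorem leftCoord_incl_mul_gen (a : A) (g : G) :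
    leftCoord G (incl G a * gen G g) = Finsupp.single g a := by
  rw [incl_mul_gen]; rfl

theorem rightCoord_gen_mul_incl (a : A) (g : G) :
    rightCoord G (gen G g * incl G a) = Finsupp.single g a := by
  simp [rightCoord, gen_mul_incl, leftCoord_incl_mul_gen]

variable (k) in
/-- A linear equivalence `M ≃ (I →₀ N)`, transferred to opposites. -/
def opCoord {I M N : Type*} [AddCommMonoid M] [AddCommMonoid N] [Module k M] [Module k N]
    (e : M ≃ₗ[k] (I →₀ N)) : Mᵐᵒᵖ ≃ₗ[k] (I →₀ Nᵐᵒᵖ) :=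
  (MulOpposite.opLinearEquiv k).symm ≪≫ₗ e ≪≫ₗ
    Finsupp.mapRange.linearEquiv (MulOpposite.opLinearEquiv k)

variable (G)

/-- The inclusion of enveloping algebras `Aᵉ → Bᵉ` for the smash product `B = A ♯ kG`. -/
def envIncl : Env k A →ₐ[k] Env k (Smash G) :=
  Algebra.TensorProduct.map (incl G) (AlgHom.op (incl G))

/-- The element `g ⊗ h` of `Bᵉ`, for `g, h ∈ G`. -/
def envGen (i : G × G) : Env k (Smash G) := gen G i.1 ⊗ₜ[k] MulOpposite.op (gen G i.2)

/-- Coordinates on `Bᵉ` with values in `Aᵉ`, built from coordinates on both factors. The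
coordinates which are compatible with the right action of `Aᵉ` use the right coordinates on the first
factor and the left coordinates on the second factor; the converse holds for the left action. -/
def envCoord (e f : Smash G ≃ₗ[k] (G →₀ A)) : Env k (Smash G) ≃ₗ[k] (G × G →₀ Env k A) :=
  TensorProduct.congr e (opCoord k f) ≪≫ₗ finsuppTensorFinsupp k k A Aᵐᵒᵖ G G

variable {G}

theorem envIncl_tmul (a b : A) :
    envIncl G (a ⊗ₜ[k] MulOpposite.op b) = incl G a ⊗ₜ[k] MulOpposite.op (incl G b) := by
  simp [envIncl]

theorem envCoord_tmul {e f : Smash G ≃ₗ[k] (G →₀ A)} {x y : Smash G} {i : G × G} {a b : A}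
    (hx : e x = Finsupp.single i.1 a) (hy : f y = Finsupp.single i.2 b) :
    envCoord G e f (x ⊗ₜ[k] MulOpposite.op y) = Finsupp.single i (a ⊗ₜ[k] MulOpposite.op b) := by
  simp [envCoord, opCoord, hx, hy]

theorem envCoord_tmul_apply (e f : Smash G ≃ₗ[k] (G →₀ A)) (x y : Smash G) (i : G × G) :
    envCoord G e f (x ⊗ₜ[k] MulOpposite.op y) i =
      e x i.1 ⊗ₜ[k] MulOpposite.op (f y i.2) := by
  obtain ⟨g, h⟩ := i
  simp [envCoord, opCoord]

theorem env_induction {p : Env k A → Prop} (add : ∀ x y, p x → p y → p (x + y))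
    (tmul : ∀ a b : A, p (a ⊗ₜ[k] MulOpposite.op b)) (r : Env k A) : p r := by
  induction r using TensorProduct.induction_on with
  | zero => simpa using tmul 0 0
  | tmul a b => exact tmul a b.unop
  | add x y hx hy => exact add x y hx hy

theorem envCoord_envGen_mul (i : G × G) (r : Env k A) :
    envCoord G (rightCoord G) (leftCoord G) (envGen G i * envIncl G r) = Finsupp.single i r := by
  induction r using env_induction with
  | add x y hx hy => rw [map_add, mul_add, map_add, hx, hy, Finsupp.single_add]
  | tmul a b =>
    rw [envIncl_tmul, envGen, Algebra.TensorProduct.tmul_mul_tmul, ← MulOpposite.op_mul]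
    exact envCoord_tmul (rightCoord_gen_mul_incl _ _) (leftCoord_incl_mul_gen _ _)

theorem envCoord_mul_envGen (i : G × G) (r : Env k A) :
    envCoord G (leftCoord G) (rightCoord G) (envIncl G r * envGen G i) = Finsupp.single i r := by
  induction r using env_induction with
  | add x y hx hy => rw [map_add, add_mul, map_add, hx, hy, Finsupp.single_add]
  | tmul a b =>
    rw [envIncl_tmul, envGen, Algebra.TensorProduct.tmul_mul_tmul, ← MulOpposite.op_mul]
    exact envCoord_tmul (leftCoord_incl_mul_gen _ _) (rightCoord_gen_mul_incl _ _)

variable (G)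

/-- `Bᵉ` is a free right `Aᵉ`-module with basis the elements `g ⊗ h` with `g, h ∈ G`. -/
def envRightBasis :
    RightBasis (R := Env k A) (S := Env k (Smash G)) (envIncl G).toRingHom (G × G) where
  vec := envGen G
  repr := (envCoord G (rightCoord G) (leftCoord G)).toAddEquiv
  repr_vec_mul := envCoord_envGen_mul

/-- Restriction of scalars from `Bᵉ` to `Aᵉ`. -/
abbrev res : ModuleCat.{v} (Env k (Smash G)) ⥤ ModuleCat.{v} (Env k A) :=
  ModuleCat.restrictScalars (envIncl G).toRingHom

/-- `Bᵉ` is a free left `Aᵉ`-module with basis the elements `g ⊗ h` with `g, h ∈ G`. -/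
def envLeftBasis : Module.Basis (G × G) (Env k A) ((res G).obj (envModule k (Smash G))) :=
  Module.Basis.ofRepr
    { (envCoord G (leftCoord G) (rightCoord G)).toAddEquiv with
      map_smul' := fun r (s : Env k (Smash G)) => by
        change envCoord G (leftCoord G) (rightCoord G) (envIncl G r * s) =
          r • envCoord G (leftCoord G) (rightCoord G) s
        obtain ⟨c, rfl⟩ := (envCoord G (leftCoord G) (rightCoord G)).symm.surjective s
        induction c using Finsupp.induction_linear with
        | zero => simp
        | add f g hf hg => rw [map_add, mul_add, map_add, map_add, smul_add, hf, hg]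
        | single i r' =>
          rw [← envCoord_mul_envGen i r', LinearEquiv.symm_apply_apply, ← mul_assoc, ← map_mul,
            envCoord_mul_envGen, envCoord_mul_envGen, Finsupp.smul_single, smul_eq_mul] }

theorem envLeftBasis_coord_tmul (i : G × G) (x y : Smash G) :
    (envLeftBasis G).coord i (x ⊗ₜ[k] MulOpposite.op y : Env k (Smash G)) =
      leftCoord G x i.1 ⊗ₜ[k] MulOpposite.op (rightCoord G y i.2) :=
  envCoord_tmul_apply _ _ x y i

end SmashProduct

/-! ### Shifts on finitely supported functions on a cyclic group -/

section Shift

variable {G X : Type*} [AddCommGroup X]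

variable (G X) in
/-- The sum of all values of a finitely supported function. -/
def total : (G →₀ X) →+ X := Finsupp.liftAddHom fun _ => AddMonoidHom.id X

@[simp]
theorem total_single (g : G) (x : X) : total G X (Finsupp.single g x) = x := by
  simp [total]

variable [Group G]

/-- The translation `single g x ↦ single (s * g) x`. -/
def shift (s : G) : (G →₀ X) →+ (G →₀ X) := Finsupp.mapDomain.addMonoidHom fun g => s * g

@[simp]
theorem shift_single (s g : G) (x : X) :
    shift s (Finsupp.single g x) = Finsupp.single (s * g) x := by
  simp [shift]

theorem total_shift (s : G) (c : G →₀ X) : total G X (shift s c) = total G X c := by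
  induction c using Finsupp.induction_linear with
  | zero => simp
  | add f g hf hg => simp [hf, hg]
  | single g x => simp

theorem shift_shift (s t : G) (c : G →₀ X) :
    shift s (shift t c) = shift (s * t) c := by
  induction c using Finsupp.induction_linear with
  | zero => rw [map_zero, map_zero, map_zero]
  | add f g hf hg => rw [map_add, map_add, map_add, hf, hg]
  | single g x => rw [shift_single, shift_single, shift_single, mul_assoc]

theorem shift_one (c : G →₀ X) : shift 1 c = c := by
  induction c using Finsupp.induction_linear with
  | zero => rw [map_zero]
  | add f g hf hg => rw [map_add, hf, hg]
  | single g x => rw [shift_single, one_mul]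

/-- The coinvariants of the translation by a generator of `G` are computed by the sum. -/
theorem exists_sub_shift_eq {s : G} (hs : ∀ g, g ∈ Subgroup.zpowers s) {c : G →₀ X}
    (hc : total G X c = 0) : ∃ d, d - shift s d = c := by
  let D : (G →₀ X) →+ (G →₀ X) := AddMonoidHom.id _ - shift s
  have hD : ∀ d, D d = d - shift s d := fun d => rfl
  -- every value can be moved to the neutral element
  have key : ∀ (n : ℤ) (x : X),
      Finsupp.single (s ^ n) x - Finsupp.single (1 : G) x ∈ D.range := by
    intro n x
    induction n using Int.induction_on with
    | zero => simp
    | succ n ih =>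
      have h : Finsupp.single (s ^ (n : ℤ)) x - Finsupp.single (s ^ ((n : ℤ) + 1)) x ∈ D.range :=
        ⟨Finsupp.single (s ^ (n : ℤ)) x, by rw [hD, shift_single, add_comm, zpow_one_add]⟩
      simpa using sub_mem ih h
    | pred n ih =>
      have h : Finsupp.single (s ^ (-(n : ℤ) - 1)) x - Finsupp.single (s ^ (-(n : ℤ))) x ∈ D.range :=
        ⟨Finsupp.single (s ^ (-(n : ℤ) - 1)) x, by
          rw [hD, shift_single, ← zpow_one_add, add_sub_cancel]⟩
      simpa using add_mem h ih
  have h : ∀ c : G →₀ X, c - Finsupp.single 1 (total G X c) ∈ D.range := by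
    intro c
    induction c using Finsupp.induction_linear with
    | zero => simp
    | add f g hf hg =>
      have := add_mem hf hg
      rwa [map_add, Finsupp.single_add, add_sub_add_comm]
    | single g x =>
      obtain ⟨n, rfl⟩ := Subgroup.mem_zpowers_iff.1 (hs g)
      simpa using key n x
  have := h c
  rw [hc, Finsupp.single_zero, sub_zero] at this
  exact this

/-- A functional which is invariant under the translation by a generator of `G` factors through the
sum. -/
theorem apply_eq_apply_single_total {Y : Type*} [AddCommGroup Y]
    {s : G} (hs : ∀ g, g ∈ Subgroup.zpowers s) (L : (G →₀ X) →+ Y)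
    (hL : ∀ d, L (shift s d) = L d) (d : G →₀ X) :
    L d = L (Finsupp.single 1 (total G X d)) := by
  have h0 : total G X (d - Finsupp.single 1 (total G X d)) = 0 := by
    rw [map_sub, total_single, sub_self]
  obtain ⟨d', hd'⟩ := exists_sub_shift_eq hs h0
  rw [← sub_eq_zero, ← map_sub, ← hd', map_sub, hL, sub_self]

/-- Translation by an element of infinite order has no nonzero finitely supported invariants. -/
theorem eq_zero_of_shift_eq {s : G} (hs : ¬ IsOfFinOrder s) {c : G →₀ X} (hc : shift s c = c) :
    c = 0 := by
  by_contra hne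
  obtain ⟨g, hg⟩ := Finsupp.ne_iff.1 hne
  have h : ∀ n : ℕ, c (s ^ n * g) = c g := by
    intro n
    induction n with
    | zero => simp
    | succ n ih =>
      rw [pow_succ', mul_assoc, ← ih]
      conv_lhs => rw [← hc]
      exact Finsupp.mapDomain_apply (mul_right_injective s) c (s ^ n * g)
  have hinj : Function.Injective fun n : ℕ => s ^ n * g :=
    (mul_left_injective g).comp (injective_pow_iff_not_isOfFinOrder.2 hs)
  refine Set.infinite_range_of_injective hinj ((c.support.finite_toSet).subset ?_)
  rintro _ ⟨n, rfl⟩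
  simpa [h n] using hg

end Shift

/-! ### The presentation of `A ♯ kG` by induced bimodules -/

section Presentation

variable {k : Type u} {A : Type v} [Field k] [Ring A] [Algebra k A]

section

variable (G : Subgroup (A ≃ₐ[k] A))

/-- The `B`-bimodule `B ⊗_A B = Bᵉ ⊗_{Aᵉ} A`, where `b ⊗ b'` corresponds to
`(b ⊗ b') ⊗ 1`, for `B = A ♯ kG`. -/
abbrev inducedBimodule : ModuleCat.{v} (Env k (Smash G)) :=
  (envRightBasis G).inductionFunctor.obj (regularBimodule k A)

variable {G}

/-- The element `s ⊗ a` of `Bᵉ ⊗_{Aᵉ} A`, that is, `x a ⊗ y` in `B ⊗_A B` if `s = x ⊗ y`. -/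
def tensor (s : Env k (Smash G)) (a : A) : inducedBimodule G :=
  (envRightBasis G).tmul (M := regularBimodule k A) s a

end

variable (μ : A ≃ₐ[k] A)

/-- The generator `μ` of the group `⟨μ⟩`. -/
def zgen : Subgroup.zpowers μ := ⟨μ, Subgroup.mem_zpowers μ⟩

/-- The unit `μ⁻¹ ⊗ μ` of `Bᵉ`. -/
def envUnit : Env k (Smash (Subgroup.zpowers μ)) :=
  gen _ (zgen μ)⁻¹ ⊗ₜ[k] MulOpposite.op (gen _ (zgen μ))

theorem gen_zgen_mul_incl (a : A) :
    gen _ (zgen μ) * incl (Subgroup.zpowers μ) a = incl _ (μ a) * gen _ (zgen μ) :=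
  gen_mul_incl _ _

theorem gen_inv_mul_incl (a : A) :
    gen _ (zgen μ)⁻¹ * incl (Subgroup.zpowers μ) (μ a) = incl _ a * gen _ (zgen μ)⁻¹ := by
  rw [gen_mul_incl]
  congr 2
  exact μ.symm_apply_apply a

theorem envAut_inv_symm_tmul (a b : A) :
    (envAut μ⁻¹).symm (a ⊗ₜ[k] MulOpposite.op b) = μ a ⊗ₜ[k] MulOpposite.op (μ b) := by
  rw [AlgEquiv.symm_apply_eq]
  simp [envAut]

theorem envUnit_mul_envIncl (r : Env k A) :
    envUnit μ * envIncl _ ((envAut μ⁻¹).symm r) = envIncl _ r * envUnit μ := by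
  induction r using env_induction with
  | add x y hx hy => rw [map_add, map_add, mul_add, map_add, add_mul, hx, hy]
  | tmul a b =>
    rw [envAut_inv_symm_tmul, envIncl_tmul, envIncl_tmul, envUnit,
      Algebra.TensorProduct.tmul_mul_tmul, Algebra.TensorProduct.tmul_mul_tmul,
      ← MulOpposite.op_mul, ← MulOpposite.op_mul, gen_inv_mul_incl, gen_zgen_mul_incl]

/-- Conjugation by the unit `μ⁻¹ ⊗ μ` of `Bᵉ` restricts to an automorphism of `Aᵉ`, hence
multiplication by this unit is an isomorphism from the twist of the restriction of a
`Bᵉ`-module to the restriction. -/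
def unitTwist : res (Subgroup.zpowers μ) ⋙ twist μ⁻¹ ⟶ res (Subgroup.zpowers μ) where
  app N := ModuleCat.ofHom (X := (twist μ⁻¹).obj ((res _).obj N)) (Y := (res _).obj N)
    { toFun := fun x : N => (envUnit μ • x : N)
      map_add' := fun (x y : N) => smul_add (envUnit μ) x y
      map_smul' := fun r (x : N) => by
        change envUnit μ • (envIncl (Subgroup.zpowers μ) ((envAut μ⁻¹).symm r) • x) =
          envIncl (Subgroup.zpowers μ) r • (envUnit μ • x)
        rw [← mul_smul, ← mul_smul, envUnit_mul_envIncl] }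
  naturality M N f := by
    apply ModuleCat.hom_ext
    ext x
    exact (map_smul f.hom (envUnit μ) (show M from x)).symm

/-- The adjunction between induction and restriction for `Aᵉ → Bᵉ`. -/
abbrev indResAdj (G : Subgroup (A ≃ₐ[k] A)) :
    (envRightBasis G).inductionFunctor ⊣ res G := (envRightBasis G).inductionAdj

/-- The endomorphism `x ⊗ y ↦ x μ⁻¹ ⊗ μ y` of the bimodule `B ⊗_A B`. It is defined
by adjunction from the map `A → B ⊗_A B`, `a ↦ μ⁻¹ ⊗ μ a`, which is linear over `Aᵉ` and factors
through the twist of `A` by `μ⁻¹`. -/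
def swapEnd : inducedBimodule (Subgroup.zpowers μ) ⟶ inducedBimodule (Subgroup.zpowers μ) :=
  ((indResAdj _).homEquiv _ _).symm
    (twistRegular μ⁻¹ ≫ (twist μ⁻¹).map ((indResAdj _).unit.app (regularBimodule k A)) ≫
      (unitTwist μ).app _)

/-- The factorization of the adjoint of `swapEnd μ` through a twist. -/
theorem unit_comp_res_swapEnd :
    (indResAdj (Subgroup.zpowers μ)).unit.app (regularBimodule k A) ≫ (res _).map (swapEnd μ) =
      twistRegular μ⁻¹ ≫ (twist μ⁻¹).map ((indResAdj _).unit.app (regularBimodule k A)) ≫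
        (unitTwist μ).app _ := by
  refine ((indResAdj (Subgroup.zpowers μ)).homEquiv_unit _ _ _).symm.trans ?_
  exact Equiv.apply_symm_apply _ _

/-- The inclusion `A → B`, as an additive map of regular bimodules. -/
def regularIncl (G : Subgroup (A ≃ₐ[k] A)) :
    regularBimodule k A →+ regularBimodule k (Smash G) :=
  (incl G : A →+ Smash G)

theorem regularIncl_smul (G : Subgroup (A ≃ₐ[k] A)) (r : Env k A) (x : regularBimodule k A) :
    regularIncl G (r • x) = envIncl G r • regularIncl G x := by
  have h : ∀ x : A, incl G (AlgHom.mulLeftRight k A r x) =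
      AlgHom.mulLeftRight k (Smash G) (envIncl G r) (incl G x) := by
    intro x
    induction r using env_induction with
    | add r s hr hs => simp only [map_add, LinearMap.add_apply, hr, hs]
    | tmul a b => simp [envIncl_tmul]
  exact h x

/-- The multiplication `B ⊗_A B → B`. -/
def mulMap (G : Subgroup (A ≃ₐ[k] A)) : inducedBimodule G ⟶ regularBimodule k (Smash G) :=
  ModuleCat.ofHom (X := (envRightBasis G).Induced (regularBimodule k A))
    (Y := regularBimodule k (Smash G))
    ((envRightBasis G).lift (regularIncl G) (regularIncl_smul G))

theorem mulMap_tensor {G : Subgroup (A ≃ₐ[k] A)} (x y : Smash G) (a : A) :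
    (mulMap G).hom (tensor (x ⊗ₜ[k] MulOpposite.op y) a) = (x * incl G a * y : Smash G) :=
  ((envRightBasis G).lift_tmul (regularIncl G) (regularIncl_smul G) _ (a : A)).trans
    (AlgHom.mulLeftRight_apply k (Smash G) x (MulOpposite.op y) (incl G a))

theorem smul_tensor {G : Subgroup (A ≃ₐ[k] A)} (s t : Env k (Smash G)) (a : A) :
    s • tensor t a = tensor (s * t) a :=
  (envRightBasis G).smul_tmul _ _ _

theorem swapEnd_tensor (s : Env k (Smash (Subgroup.zpowers μ))) (a : A) :
    (swapEnd μ).hom (tensor s a) = tensor (s * envUnit μ) (μ a) := by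
  have h : (swapEnd μ).hom (tensor 1 a) = tensor (envUnit μ) (μ a) := by
    have h := ConcreteCategory.congr_hom (unit_comp_res_swapEnd μ) a
    refine h.trans ?_
    exact (smul_tensor (envUnit μ) 1 (μ a)).trans (by rw [mul_one])
  rw [← mul_one s, ← smul_tensor, map_smul, h, smul_tensor, mul_one]

end Presentation

section Presentation

variable {k : Type u} {A : Type v} [Field k] [Ring A] [Algebra k A] (μ : A ≃ₐ[k] A)

section Coordinates

variable (G : Subgroup (A ≃ₐ[k] A))

/-- The isomorphism `B ⊗_A B ≃ ⨁_{g ∈ G} B` which maps `g ⊗ y` to `g y` in the summand of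
index `g`. -/
def inducedCoord : inducedBimodule G ≃+ (G →₀ Smash G) :=
  Finsupp.curryAddEquiv.trans <| AddEquiv.trans (finsuppCongr (k := ℕ) fun _ =>
    ((leftCoord G).symm.toAddEquiv).toNatLinearEquiv).toAddEquiv
    (finsuppCongr (k := k) fun g => LinearEquiv.ofLinearMap
      (LinearMap.mulLeft k (gen G g)) (LinearMap.mulLeft k (gen G g⁻¹))
      (by ext x; simp [← mul_assoc, ← map_mul])
      (by ext x; simp [← mul_assoc, ← map_mul])).toAddEquiv

variable {G}

theorem tensor_gen (i : G × G) (a : A) :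
    tensor (envGen G i) a = (envRightBasis G).incl (M := regularBimodule k A) i a :=
  (envRightBasis G).tmul_vec i _

theorem inducedCoord_tensor (i : G × G) (a : A) :
    inducedCoord G (tensor (envGen G i) a) =
      Finsupp.single i.1 (gen G i.1 * (incl G a * gen G i.2)) := by
  have h : (leftCoord G).symm (Finsupp.single i.2 a) = incl G a * gen G i.2 := by
    rw [← leftCoord_incl_mul_gen, LinearEquiv.symm_apply_apply]
  have hc : Finsupp.curryAddEquiv (Finsupp.single i a) =
      Finsupp.single i.1 (Finsupp.single i.2 a) := Finsupp.curry_single i a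
  rw [tensor_gen]
  change finsuppCongr _ (finsuppCongr _ (Finsupp.curryAddEquiv (Finsupp.single i a))) = _
  rw [hc, finsuppCongr_single, finsuppCongr_single]
  exact congrArg (fun x => Finsupp.single i.1 (gen G i.1 * x)) h

theorem inducedBimodule_hom_ext {N : Type*} [AddCommGroup N] {f g : inducedBimodule G →+ N}
    (h : ∀ i a, f (tensor (envGen G i) a) = g (tensor (envGen G i) a)) : f = g :=
  (envRightBasis G).induced_hom_ext fun i a =>
    (congrArg f (tensor_gen i a)).symm.trans ((h i a).trans (congrArg g (tensor_gen i a)))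

end Coordinates

theorem envGen_mul_envUnit (i : Subgroup.zpowers μ × Subgroup.zpowers μ) :
    envGen _ i * envUnit μ = envGen _ (i.1 * (zgen μ)⁻¹, zgen μ * i.2) := by
  rw [envGen, envUnit, envGen, Algebra.TensorProduct.tmul_mul_tmul, ← MulOpposite.op_mul, map_mul,
    map_mul]

theorem mul_zgen_inv (g : Subgroup.zpowers μ) : g * (zgen μ)⁻¹ = (zgen μ)⁻¹ * g := by
  obtain ⟨_, n, rfl⟩ := g
  exact Subtype.ext (((Commute.refl μ).zpow_left n).inv_right)

/-- In the coordinates `B ⊗_A B ≃ ⨁_{g ∈ G} B`, the endomorphism `x ⊗ y ↦ x μ⁻¹ ⊗ μ y` translates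
the index and does not change the entries. -/
theorem inducedCoord_swapEnd (c : inducedBimodule (Subgroup.zpowers μ)) :
    inducedCoord _ ((swapEnd μ).hom c) = shift (zgen μ)⁻¹ (inducedCoord _ c) := by
  have h : (inducedCoord _).toAddMonoidHom.comp (swapEnd μ).hom.toAddMonoidHom =
      (shift (zgen μ)⁻¹).comp (inducedCoord _).toAddMonoidHom := by
    refine inducedBimodule_hom_ext fun i a => ?_
    change inducedCoord _ ((swapEnd μ).hom (tensor (envGen _ i) a)) =
      shift (zgen μ)⁻¹ (inducedCoord _ (tensor (envGen _ i) a))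
    rw [swapEnd_tensor, envGen_mul_envUnit, inducedCoord_tensor, inducedCoord_tensor, shift_single,
      mul_zgen_inv]
    congr 1
    have h : gen _ (zgen μ)⁻¹ * (incl (Subgroup.zpowers μ) (μ a) * gen _ (zgen μ * i.2)) =
        incl _ a * gen _ i.2 := by
      rw [← mul_assoc, gen_inv_mul_incl, mul_assoc, ← map_mul, inv_mul_cancel_left]
    rw [← mul_zgen_inv, map_mul, mul_assoc, h]
  exact DFunLike.congr_fun h c

theorem total_inducedCoord (G : Subgroup (A ≃ₐ[k] A)) (c : inducedBimodule G) :
    total G (Smash G) (inducedCoord G c) = (mulMap G).hom c := by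
  have h : (total G (Smash G)).comp (inducedCoord G).toAddMonoidHom =
      (mulMap G).hom.toAddMonoidHom := by
    refine inducedBimodule_hom_ext fun i a => ?_
    change total G (Smash G) (inducedCoord G (tensor (envGen G i) a)) =
      (mulMap G).hom (tensor (envGen G i) a)
    rw [inducedCoord_tensor, total_single, ← mul_assoc]
    exact (mulMap_tensor _ _ _).symm
  exact DFunLike.congr_fun h c

theorem swapEnd_comp_mulMap : swapEnd μ ≫ mulMap _ = mulMap _ := by
  apply ModuleCat.hom_ext
  ext c
  change (mulMap _).hom ((swapEnd μ).hom c) = (mulMap _).hom c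
  rw [← total_inducedCoord, ← total_inducedCoord, inducedCoord_swapEnd, total_shift]

theorem mulMap_surjective (G : Subgroup (A ≃ₐ[k] A)) : Function.Surjective (mulMap G).hom := by
  intro (x : Smash G)
  obtain ⟨c, hc⟩ := (inducedCoord G).surjective (Finsupp.single 1 x)
  exact ⟨c, (total_inducedCoord G c).symm.trans
    ((congrArg (total G (Smash G)) hc).trans (total_single 1 x))⟩

theorem zgen_generates (g : Subgroup.zpowers μ) : g ∈ Subgroup.zpowers (zgen μ)⁻¹ := by
  rw [Subgroup.zpowers_inv]
  obtain ⟨_, n, rfl⟩ := g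
  exact ⟨n, Subtype.ext (by simp [zgen])⟩

/-- The sequence `B ⊗_A B → B ⊗_A B → B → 0`, with first map `1 - swapEnd μ`, is exact. -/
theorem exists_sub_swapEnd_eq {c : inducedBimodule (Subgroup.zpowers μ)}
    (hc : (mulMap _).hom c = 0) : ∃ d, d - (swapEnd μ).hom d = c := by
  obtain ⟨d, hd⟩ := exists_sub_shift_eq (zgen_generates μ) ((total_inducedCoord _ c).trans hc)
  refine ⟨(inducedCoord _).symm d, (inducedCoord _).injective ?_⟩
  rw [map_sub, inducedCoord_swapEnd, AddEquiv.apply_symm_apply, hd]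

theorem zgen_isOfFinOrder : IsOfFinOrder (zgen μ)⁻¹ ↔ IsOfFinOrder μ := by
  rw [isOfFinOrder_inv_iff, ← Submonoid.isOfFinOrder_coe (H := (Subgroup.zpowers μ).toSubmonoid)]
  rfl

theorem eq_zero_of_swapEnd_eq (hμ : ¬ IsOfFinOrder μ)
    {c : inducedBimodule (Subgroup.zpowers μ)} (hc : (swapEnd μ).hom c = c) : c = 0 := by
  have h := inducedCoord_swapEnd μ c
  rw [hc] at h
  exact (inducedCoord _).injective
    ((eq_zero_of_shift_eq (mt (zgen_isOfFinOrder μ).1 hμ) h.symm).trans (map_zero _).symm)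

end Presentation

/-! ### The groups `Ext^i_{Bᵉ}(B ⊗_A B, Bᵉ)` -/

section InducedExt

open Abelian

variable {k : Type u} {A : Type v} [Field k] [Ring A] [Algebra k A]

section

variable {G : Subgroup (A ≃ₐ[k] A)}

/-- The `Aᵉ`-linear map `Aᵉ → Bᵉ`, `r ↦ r s`. -/
def orbitMap (s : Env k (Smash G)) : envModule k A ⟶ (res G).obj (envModule k (Smash G)) :=
  ModuleCat.ofHom (X := Env k A) (Y := (res G).obj (envModule k (Smash G)))
    (LinearMap.toSpanSingleton (Env k A) ((res G).obj (envModule k (Smash G))) s)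

theorem orbitMap_add (s t : Env k (Smash G)) : orbitMap (s + t) = orbitMap s + orbitMap t := by
  apply ModuleCat.hom_ext
  refine LinearMap.ext fun (x : Env k A) => ?_
  exact mul_add (envIncl G x) s t

theorem rightMul_orbitMap (r : Env k A) (s : Env k (Smash G)) :
    rightMul r ≫ orbitMap s = orbitMap (envIncl G r * s) := by
  apply ModuleCat.hom_ext
  refine LinearMap.ext fun (x : Env k A) => ?_
  change envIncl G (x * r) * s = envIncl G x * (envIncl G r * s)
  rw [map_mul, mul_assoc]

theorem orbitMap_rightMul (s t : Env k (Smash G)) :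
    orbitMap s ≫ (res G).map (rightMul t) = orbitMap (s * t) := by
  apply ModuleCat.hom_ext
  refine LinearMap.ext fun (x : Env k A) => ?_
  exact mul_assoc (envIncl G x) s t

variable (G) in
/-- The image of `d ⊗ s` under the canonical map
`Ext^i_{Aᵉ}(A, Aᵉ) ⊗_{Aᵉ} Bᵉ → Ext^i_{Aᵉ}(A, Bᵉ)`. -/
def extend {i : ℕ} (d : DualExt k A i) : Env k (Smash G) →+
    Ext (regularBimodule k A) ((res G).obj (envModule k (Smash G))) i where
  toFun s := d.comp (Ext.mk₀ (orbitMap s)) (add_zero i)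
  map_zero' := by
    have : orbitMap (0 : Env k (Smash G)) = 0 := by
      simpa using orbitMap_add (0 : Env k (Smash G)) 0
    rw [this, Ext.mk₀_zero, Ext.comp_zero]
  map_add' s t := by rw [orbitMap_add, Ext.mk₀_add, Ext.comp_add]

theorem extend_apply {i : ℕ} (d : DualExt k A i) (s : Env k (Smash G)) :
    extend G d s = d.comp (Ext.mk₀ (orbitMap s)) (add_zero i) := rfl

theorem extend_comp_rightMul {i : ℕ} (d : DualExt k A i) (r : Env k A) (s : Env k (Smash G)) :
    extend G (d.comp (Ext.mk₀ (rightMul r)) (add_zero i)) s = extend G d (envIncl G r * s) := by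
  rw [extend_apply, extend_apply, ← rightMul_orbitMap, ← Ext.mk₀_comp_mk₀,
    Ext.comp_assoc _ _ _ (add_zero i) (zero_add 0) (by lia)]

theorem extend_lact {i : ℕ} (d : DualExt k A i) (a : A) (x y : Smash G) :
    extend G (lact a d) (x ⊗ₜ[k] MulOpposite.op y) =
      extend G d (x ⊗ₜ[k] MulOpposite.op (y * incl G a)) := by
  rw [lact, extend_comp_rightMul, envIncl_tmul, Algebra.TensorProduct.tmul_mul_tmul, map_one,
    one_mul, MulOpposite.op_mul]

theorem extend_ract {i : ℕ} (d : DualExt k A i) (a : A) (x y : Smash G) :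
    extend G (ract d a) (x ⊗ₜ[k] MulOpposite.op y) =
      extend G d ((incl G a * x) ⊗ₜ[k] MulOpposite.op y) := by
  rw [ract, extend_comp_rightMul, ← MulOpposite.op_one, envIncl_tmul,
    Algebra.TensorProduct.tmul_mul_tmul, map_one, MulOpposite.op_one, one_mul]

theorem extend_comp_res_rightMul {i : ℕ} (d : DualExt k A i) (s t : Env k (Smash G)) :
    (extend G d s).comp (Ext.mk₀ ((res G).map (rightMul t))) (add_zero i) =
      extend G d (s * t) := by
  rw [extend_apply, extend_apply, ← orbitMap_rightMul, ← Ext.mk₀_comp_mk₀,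
    Ext.comp_assoc _ _ _ (add_zero i) (zero_add 0) (by lia)]

variable (G) in
/-- `Ext^i_{Aᵉ}(A, Bᵉ)` is generated by the images of the pure tensors, because `Bᵉ` is free over
`Aᵉ`. -/
theorem mem_closure_extend {m : ℕ}
    (hA : HasFiniteResolution (Env k A) m (regularBimodule k A)) {i : ℕ}
    (x : Ext (regularBimodule k A) ((res G).obj (envModule k (Smash G))) i) :
    x ∈ AddSubgroup.closure {y | ∃ d s, extend G d s = y} := by
  refine AddSubgroup.closure_mono ?_ (ext_free_mem_closure _ (envLeftBasis G) hA x)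
  rintro _ ⟨d, f, rfl⟩
  refine ⟨d, f.hom (1 : Env k A), congrArg (fun f => d.comp (Ext.mk₀ f) (add_zero i)) ?_⟩
  apply ModuleCat.hom_ext
  refine LinearMap.ext_ring ?_
  exact LinearMap.toSpanSingleton_apply_one _ _ _

/-- The coordinate `j` on the free `Aᵉ`-module `Bᵉ`. -/
def coordMap (j : G × G) : (res G).obj (envModule k (Smash G)) ⟶ envModule k A :=
  ModuleCat.ofHom (X := (res G).obj (envModule k (Smash G))) (Y := Env k A)
    ((envLeftBasis G).coord j)

/-- The value of the canonical map `Ext^i_{Aᵉ}(A, Aᵉ) ⊗_{Aᵉ} Bᵉ → Ext^i_{Aᵉ}(A, Bᵉ)` in the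
coordinates of `Bᵉ`. -/
theorem extend_comp_coord {i : ℕ} (d : DualExt k A i) (s : Env k (Smash G)) (j : G × G) :
    (extend G d s).comp (Ext.mk₀ (coordMap j)) (add_zero i) =
      d.comp (Ext.mk₀ (rightMul ((envLeftBasis G).coord j s))) (add_zero i) := by
  have h : orbitMap s ≫ coordMap j =
      rightMul ((envLeftBasis G).coord j s) := by
    apply ModuleCat.hom_ext
    refine LinearMap.ext fun (x : Env k A) => ?_
    exact ((envLeftBasis G).coord j).map_smul x
      (show ((res G).obj (envModule k (Smash G)) : Type v) from s)
  rw [extend_apply, ← h, ← Ext.mk₀_comp_mk₀,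
    Ext.comp_assoc _ _ _ (add_zero i) (zero_add 0) (by lia)]

instance : Limits.PreservesFiniteLimits (res (k := k) G) :=
  have := (indResAdj (k := k) G).rightAdjoint_preservesLimits
  inferInstance

variable (G) in
/-- The adjunction isomorphism `Ext^i_{Bᵉ}(B ⊗_A B, Bᵉ) → Ext^i_{Aᵉ}(A, Bᵉ)`. -/
def adjExt (i : ℕ) : Ext (inducedBimodule G) (envModule k (Smash G)) i →+
    Ext (regularBimodule k A) ((res G).obj (envModule k (Smash G))) i :=
  extAdj (indResAdj G) (regularBimodule k A) (envModule k (Smash G)) i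

variable (G) in
theorem adjExt_bijective (i : ℕ) : Function.Bijective (adjExt (k := k) G i) :=
  extAdj_bijective (indResAdj G) _ _ i

theorem adjExt_comp_rightMul {i : ℕ} (x : Ext (inducedBimodule G) (envModule k (Smash G)) i)
    (t : Env k (Smash G)) :
    adjExt G i (x.comp (Ext.mk₀ (rightMul t)) (add_zero i)) =
      (adjExt G i x).comp (Ext.mk₀ ((res G).map (rightMul t))) (add_zero i) := by
  rw [adjExt, extAdj_comp, Ext.mapExactFunctor_mk₀]

theorem subsingleton_ext_inducedBimodule {m : ℕ}
    (hA : HasFiniteResolution (Env k A) m (regularBimodule k A)) {i : ℕ}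
    (h : Subsingleton (DualExt k A i)) :
    Subsingleton (Ext (inducedBimodule G) (envModule k (Smash G)) i) := by
  have h0 : ∀ x : Ext (regularBimodule k A) ((res G).obj (envModule k (Smash G))) i, x = 0 := by
    intro x
    have hx := mem_closure_extend G hA x
    have : {y | ∃ d s, extend (i := i) G d s = y} ⊆ {0} := by
      rintro _ ⟨d, s, rfl⟩
      rw [Subsingleton.elim d 0, extend_apply, Ext.zero_comp]
      rfl
    exact (AddSubgroup.closure_singleton_zero.le) (AddSubgroup.closure_mono this hx)
  exact ⟨fun x y => (adjExt_bijective G i).1 ((h0 _).trans (h0 _).symm)⟩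

end

section Twist

variable (μ : A ≃ₐ[k] A)

theorem twist_orbitMap_unitTwist (s : Env k (Smash (Subgroup.zpowers μ))) :
    (twist μ⁻¹).map (orbitMap s) ≫ (unitTwist μ).app (envModule k (Smash (Subgroup.zpowers μ))) =
      untwistEnv μ⁻¹ ≫ orbitMap (envUnit μ * s) := by
  apply ModuleCat.hom_ext
  refine LinearMap.ext fun (x : Env k A) => ?_
  change envUnit μ * (envIncl _ x * s) = envIncl _ (envAut μ⁻¹ x) * (envUnit μ * s)
  rw [← mul_assoc, ← mul_assoc, ← envUnit_mul_envIncl, AlgEquiv.symm_apply_apply]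

/-- The effect of the endomorphism `x ⊗ y ↦ x μ⁻¹ ⊗ μ y` of `B ⊗_A B` on `Ext`. -/
theorem adjExt_swapEnd_comp_of_eq_extend {i : ℕ}
    {x : Ext (inducedBimodule (Subgroup.zpowers μ)) (envModule k (Smash (Subgroup.zpowers μ))) i}
    {d : DualExt k A i} {s : Env k (Smash (Subgroup.zpowers μ))} (hx : adjExt _ i x = extend _ d s) :
    adjExt _ i ((Ext.mk₀ (swapEnd μ)).comp x (zero_add i)) =
      extend _ (autAct μ⁻¹ d) (envUnit μ * s) := by
  exact extAdj_mk₀_comp_of_square (indResAdj _) (unit_comp_res_swapEnd μ)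
    (twist_orbitMap_unitTwist μ s) hx

end Twist

end InducedExt

/-! ### The coordinates on `Ext^n_{Bᵉ}(B ⊗_A B, Bᵉ)` -/

section Generator

open Abelian

variable {k : Type u} {A : Type v} [Field k] [Ring A] [Algebra k A]

theorem rightMul_one : rightMul (1 : Env k A) = 𝟙 _ := by
  apply ModuleCat.hom_ext
  exact LinearMap.ext fun (x : Env k A) => mul_one x

theorem rightMul_add (r s : Env k A) : rightMul (r + s) = rightMul r + rightMul s := by
  apply ModuleCat.hom_ext
  exact LinearMap.ext fun (x : Env k A) => mul_add x r s

theorem lact_one {i : ℕ} (d : DualExt k A i) : lact 1 d = d := by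
  rw [lact, MulOpposite.op_one, ← Algebra.TensorProduct.one_def, rightMul_one, Ext.comp_mk₀_id]

theorem lact_zero {i : ℕ} (d : DualExt k A i) : lact 0 d = 0 := by
  have h := rightMul_add (0 : Env k A) 0
  rw [add_zero, left_eq_add] at h
  rw [lact, MulOpposite.op_zero, TensorProduct.tmul_zero, h, Ext.mk₀_zero, Ext.comp_zero]

theorem ract_add {i : ℕ} (d : DualExt k A i) (a b : A) : ract d (a + b) = ract d a + ract d b := by
  rw [ract, TensorProduct.add_tmul, rightMul_add, Ext.mk₀_add, Ext.comp_add]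
  rfl

theorem IsFreeGenerator.eq_zero {n : ℕ} {e : DualExt k A n} (he : IsFreeGenerator e) {a : A}
    (ha : lact a e = 0) : a = 0 :=
  (he 0).unique ha.symm (lact_zero e).symm

/-- The free generator is invariant under `μ⁻¹` if the weak homological determinant takes the
value `1` at `μ`. -/
theorem autAct_inv_eq_self {n : ℕ} {e : DualExt k A n} (he : IsFreeGenerator e) (μ : A ≃ₐ[k] A)
    {w : MonoidAlgebra k (Subgroup.zpowers μ) →ₗ[k] A}
    (hw : IsWeakHomologicalDeterminant (Subgroup.zpowers μ) e w)
    (hdet : w (MonoidAlgebra.of k _ ⟨μ, Subgroup.mem_zpowers μ⟩) = 1) :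
    autAct μ⁻¹ e = e := by
  obtain ⟨f, hf, hfe, hfw⟩ := hw
  have h := hfw ⟨μ, Subgroup.mem_zpowers μ⟩ e
  rw [hdet, hfe, mul_one] at h
  have h1 : f (autAct μ⁻¹ e) = 1 := μ.injective (h.trans (map_one μ).symm)
  obtain ⟨a, ha, -⟩ := he (autAct μ⁻¹ e)
  have ha1 : a = 1 := by rw [← h1, ha, hf, hfe, mul_one]
  rw [ha, ha1, lact_one]

/-- The adjunction isomorphism `Ext^i_{Bᵉ}(B ⊗_A B, Bᵉ) ≃ Ext^i_{Aᵉ}(A, Bᵉ)`. -/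
def adjExtEquiv (G : Subgroup (A ≃ₐ[k] A)) (i : ℕ) :
    Abelian.Ext (inducedBimodule G) (envModule k (Smash G)) i ≃+
      Abelian.Ext (regularBimodule k A) ((res G).obj (envModule k (Smash G))) i :=
  AddEquiv.ofBijective (adjExt G i) (adjExt_bijective G i)

variable {μ : A ≃ₐ[k] A}

/-- The additive map `⨁_{g ∈ ⟨μ⟩} B → Bᵉ` which maps `b` in the summand of index `g` to
`g ⊗ b (μ g)⁻¹`. -/
def envOfCoord (μ : A ≃ₐ[k] A) :
    (Subgroup.zpowers μ →₀ Smash (Subgroup.zpowers μ)) →+ Env k (Smash (Subgroup.zpowers μ)) :=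
  Finsupp.liftAddHom fun g =>
    { toFun := fun b => gen _ g ⊗ₜ[k] MulOpposite.op (b * gen _ (zgen μ * g)⁻¹)
      map_zero' := by rw [zero_mul, MulOpposite.op_zero, TensorProduct.tmul_zero]
      map_add' := fun x y => by rw [add_mul, MulOpposite.op_add, TensorProduct.tmul_add] }

theorem envOfCoord_single (g : Subgroup.zpowers μ) (b : Smash (Subgroup.zpowers μ)) :
    envOfCoord μ (Finsupp.single g b) =
      gen _ g ⊗ₜ[k] MulOpposite.op (b * gen _ (zgen μ * g)⁻¹) :=
  Finsupp.liftAddHom_apply_single _ _ _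

/-- Left multiplication by `μ⁻¹ ⊗ μ` translates the index by `μ⁻¹` and does not change the entries;
this is the reason for the factor `(μ g)⁻¹` in `envOfCoord`. -/
theorem envUnit_mul_envOfCoord (c : Subgroup.zpowers μ →₀ Smash (Subgroup.zpowers μ)) :
    envUnit μ * envOfCoord μ c = envOfCoord μ (shift (zgen μ)⁻¹ c) := by
  induction c using Finsupp.induction_linear with
  | zero => rw [map_zero, map_zero, map_zero, mul_zero]
  | add f g hf hg => rw [map_add, map_add, map_add, mul_add, hf, hg]
  | single g b =>
    rw [shift_single, envOfCoord_single, envOfCoord_single, envUnit,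
      Algebra.TensorProduct.tmul_mul_tmul, ← MulOpposite.op_mul, ← map_mul, mul_assoc b, ← map_mul]
    congr 5
    group

/-- The coordinates of `envOfCoord μ c` lie in `1 ⊗ Aᵒᵖ`, so that they act on the generator `e` by
the free left action of `A`. -/
theorem coord_envOfCoord (c : Subgroup.zpowers μ →₀ Smash (Subgroup.zpowers μ))
    (i : Subgroup.zpowers μ × Subgroup.zpowers μ) :
    (envLeftBasis _).coord i (envOfCoord μ c) =
      1 ⊗ₜ[k] MulOpposite.op (rightCoord _ (c i.1 * gen _ (zgen μ * i.1)⁻¹) i.2) := by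
  induction c using Finsupp.induction_linear with
  | zero =>
    rw [map_zero, Finsupp.zero_apply, zero_mul, map_zero, Finsupp.zero_apply, MulOpposite.op_zero,
      TensorProduct.tmul_zero]
    exact map_zero ((envLeftBasis _).coord i)
  | add f g hf hg =>
    rw [map_add, Finsupp.add_apply, add_mul, map_add, Finsupp.add_apply, MulOpposite.op_add,
      TensorProduct.tmul_add, ← hf, ← hg]
    exact map_add ((envLeftBasis _).coord i) _ _
  | single g b =>
    rw [envOfCoord_single, envLeftBasis_coord_tmul, ← one_mul (gen _ g), ← map_one (incl _),
      leftCoord_incl_mul_gen]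
    by_cases h : g = i.1
    · rw [h, Finsupp.single_eq_same, Finsupp.single_eq_same]
    · rw [Finsupp.single_eq_of_ne' h, Finsupp.single_eq_of_ne' h, zero_mul, map_zero,
        TensorProduct.zero_tmul, Finsupp.zero_apply, MulOpposite.op_zero, TensorProduct.tmul_zero]

section

variable {n : ℕ} {e : DualExt k A n}

/-- The additive map `⨁_{g ∈ ⟨μ⟩} B → Ext^n_{Aᵉ}(A, Bᵉ)` which maps `b` in the summand of index `g`
to the image of `e ⊗ (g ⊗ b (μ g)⁻¹)`. -/
def extendCoord (μ : A ≃ₐ[k] A) (e : DualExt k A n) :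
    (Subgroup.zpowers μ →₀ Smash (Subgroup.zpowers μ)) →+
      Abelian.Ext (regularBimodule k A)
        ((res (Subgroup.zpowers μ)).obj (envModule k (Smash (Subgroup.zpowers μ)))) n :=
  (extend (Subgroup.zpowers μ) e).comp (envOfCoord μ)

theorem extendCoord_apply (c : Subgroup.zpowers μ →₀ Smash (Subgroup.zpowers μ)) :
    extendCoord μ e c = extend (Subgroup.zpowers μ) e (envOfCoord μ c) := rfl

theorem extend_envOfCoord_injective (he : IsFreeGenerator e)
    {c : Subgroup.zpowers μ →₀ Smash (Subgroup.zpowers μ)}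
    (hc : extend _ e (envOfCoord μ c) = 0) : c = 0 := by
  ext1 g
  have h : rightCoord _ (c g * gen _ (zgen μ * g)⁻¹) = 0 := by
    ext1 h
    refine he.eq_zero ?_
    rw [lact, ← coord_envOfCoord c (g, h), ← extend_comp_coord, hc, Ext.zero_comp]
  rw [LinearEquiv.map_eq_zero_iff] at h
  rw [Finsupp.zero_apply, ← mul_one (c g), ← map_one (gen _), ← inv_mul_cancel (zgen μ * g),
    map_mul, ← mul_assoc, h, zero_mul]

/-- The relation `e a = μ(a) e`, in `Ext^n_{Aᵉ}(A, Bᵉ)`. -/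
theorem extend_incl_mul (hμ : ∀ a : A, ract e a = lact (μ a) e) (a : A)
    (x y : Smash (Subgroup.zpowers μ)) :
    extend _ e ((incl _ a * x) ⊗ₜ[k] MulOpposite.op y) =
      extend _ e (x ⊗ₜ[k] MulOpposite.op (y * incl _ (μ a))) := by
  rw [← extend_ract, hμ, extend_lact]

theorem extend_mem_range (hμ : ∀ a : A, ract e a = lact (μ a) e)
    (x y : Smash (Subgroup.zpowers μ)) :
    extend _ e (x ⊗ₜ[k] MulOpposite.op y) ∈ (extendCoord μ e).range := by
  induction x using smash_induction with
  | zero => rw [TensorProduct.zero_tmul, map_zero]; exact zero_mem _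
  | add x x' hx hx' => rw [TensorProduct.add_tmul, map_add]; exact add_mem hx hx'
  | incl_mul_gen a g =>
    refine ⟨Finsupp.single g (y * incl _ (μ a) * gen _ (zgen μ * g)), ?_⟩
    rw [extendCoord_apply, envOfCoord_single, mul_assoc _ (gen _ (zgen μ * g)), ← map_mul,
      mul_inv_cancel, map_one, mul_one, extend_incl_mul hμ]

theorem extend_envOfCoord_surjective {m : ℕ}
    (hA : HasFiniteResolution (Env k A) m (regularBimodule k A)) (he : IsFreeGenerator e)
    (hμ : ∀ a : A, ract e a = lact (μ a) e) :
    Function.Surjective (extendCoord μ e) := by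
  intro x
  rw [← AddMonoidHom.mem_range]
  refine (AddSubgroup.closure_le _).2 ?_ (mem_closure_extend _ hA x)
  rintro _ ⟨d, s, rfl⟩
  obtain ⟨a, rfl, -⟩ := he d
  change extend _ (lact a e) s ∈ (extendCoord μ e).range
  induction s using env_induction with
  | add x y hx hy => rw [map_add]; exact add_mem hx hy
  | tmul x y => rw [extend_lact]; exact extend_mem_range hμ _ _

theorem extendCoord_bijective {m : ℕ}
    (hA : HasFiniteResolution (Env k A) m (regularBimodule k A)) (he : IsFreeGenerator e)
    (hμ : ∀ a : A, ract e a = lact (μ a) e) : Function.Bijective (extendCoord μ e) :=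
  ⟨(injective_iff_map_eq_zero (extendCoord μ e)).2 fun _ hc => extend_envOfCoord_injective he hc,
    extend_envOfCoord_surjective hA he hμ⟩

/-- The isomorphism `⨁_{g ∈ ⟨μ⟩} B ≃ Ext^n_{Bᵉ}(B ⊗_A B, Bᵉ)` obtained from a generator `e` of the
`A`-bimodule `Ext^n_{Aᵉ}(A, Aᵉ)`. -/
def extCoord {m : ℕ} (hA : HasFiniteResolution (Env k A) m (regularBimodule k A))
    (he : IsFreeGenerator e) (hμ : ∀ a : A, ract e a = lact (μ a) e) :
    (Subgroup.zpowers μ →₀ Smash (Subgroup.zpowers μ)) ≃+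
      Abelian.Ext (inducedBimodule (Subgroup.zpowers μ))
        (envModule k (Smash (Subgroup.zpowers μ))) n :=
  (AddEquiv.ofBijective (extendCoord μ e) (extendCoord_bijective hA he hμ)).trans
    (adjExtEquiv (Subgroup.zpowers μ) n).symm

variable {m : ℕ} (hA : HasFiniteResolution (Env k A) m (regularBimodule k A))
    (he : IsFreeGenerator e) (hμ : ∀ a : A, ract e a = lact (μ a) e)

theorem adjExt_extCoord (c : Subgroup.zpowers μ →₀ Smash (Subgroup.zpowers μ)) :
    adjExt (Subgroup.zpowers μ) n (extCoord hA he hμ c) = extend _ e (envOfCoord μ c) :=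
  (adjExtEquiv (Subgroup.zpowers μ) n).apply_symm_apply (extendCoord μ e c)

/-- If `μ⁻¹` fixes the generator, then the endomorphism `x ⊗ y ↦ x μ⁻¹ ⊗ μ y` of `B ⊗_A B`
translates the coordinates. -/
theorem swapEnd_comp_extCoord (hfix : autAct μ⁻¹ e = e)
    (c : Subgroup.zpowers μ →₀ Smash (Subgroup.zpowers μ)) :
    (Ext.mk₀ (swapEnd μ)).comp (extCoord hA he hμ c) (zero_add n) =
      extCoord hA he hμ (shift (zgen μ)⁻¹ c) := by
  apply (adjExt_bijective _ n).1
  rw [adjExt_swapEnd_comp_of_eq_extend μ (adjExt_extCoord hA he hμ c), hfix, adjExt_extCoord,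
    envUnit_mul_envOfCoord]

/-- The left action of `B`, in coordinates. -/
theorem extCoord_comp_rightMul_op (g : Subgroup.zpowers μ)
    (b b' : Smash (Subgroup.zpowers μ)) :
    (extCoord hA he hμ (Finsupp.single g b)).comp
        (Ext.mk₀ (rightMul (1 ⊗ₜ[k] MulOpposite.op b'))) (add_zero n) =
      extCoord hA he hμ (Finsupp.single g (b' * b)) := by
  apply (adjExt_bijective _ n).1
  rw [adjExt_comp_rightMul, adjExt_extCoord, adjExt_extCoord, extend_comp_res_rightMul,
    envOfCoord_single, envOfCoord_single, Algebra.TensorProduct.tmul_mul_tmul, mul_one,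
    ← MulOpposite.op_mul, mul_assoc]

/-- The right action of `B`, in coordinates: there is no twist, since the factor `μ⁻¹` of `(μ g)⁻¹`
undoes the automorphism in `e a = μ(a) e`. -/
theorem extCoord_comp_rightMul (g h : Subgroup.zpowers μ) (b : Smash (Subgroup.zpowers μ))
    (a : A) :
    (extCoord hA he hμ (Finsupp.single g b)).comp
        (Ext.mk₀ (rightMul ((incl _ a * gen _ h) ⊗ₜ[k] 1))) (add_zero n) =
      extCoord hA he hμ (Finsupp.single (g * h) (b * (incl _ a * gen _ h))) := by
  have h1 : gen _ (zgen μ * g)⁻¹ * incl (Subgroup.zpowers μ) (μ ((g : A ≃ₐ[k] A) a)) =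
      incl _ a * gen _ (zgen μ * g)⁻¹ := by
    rw [gen_mul_incl]
    congr 2
    exact ((zgen μ * g : Subgroup.zpowers μ) : A ≃ₐ[k] A).symm_apply_apply a
  apply (adjExt_bijective _ n).1
  rw [adjExt_comp_rightMul, adjExt_extCoord, adjExt_extCoord, extend_comp_res_rightMul,
    envOfCoord_single, envOfCoord_single, Algebra.TensorProduct.tmul_mul_tmul, mul_one,
    ← mul_assoc, gen_mul_incl, mul_assoc (incl _ _), ← map_mul, extend_incl_mul hμ, mul_assoc b,
    h1, mul_assoc b, mul_assoc (incl _ a), ← map_mul]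
  congr 6
  group

end

end Generator

/-! ### Descent of Ext along the quotient by `1 - τ` -/

section Descent

open Abelian

variable {C : Type*} [Category* C] [Abelian C] {X Y Z : C} {τ : X ⟶ X} {π : X ⟶ Z}

/-- If `τ ^ N = 1`, the norm `∑_{i < N} τ^i` factors through the quotient `π : X → Z` by `1 - τ`, and
the map `Z → X` is a section of `π` up to the factor `N`, which is assumed to be invertible on
`Z`. -/
theorem exists_nsmul_section {N : ℕ} (hτN : End.of τ ^ N = 1) (hτπ : τ ≫ π = π)
    (w : (𝟙 X - τ) ≫ π = 0) (hS : (ShortComplex.mk (𝟙 X - τ) π w).Exact) (hπ : Epi π)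
    {r : Z ⟶ Z} (hr : N • r = 𝟙 Z) :
    ∃ s : Z ⟶ X, s ≫ π = 𝟙 Z ∧ s ≫ τ = s ∧
      N • (π ≫ s) = (∑ i ∈ Finset.range N, End.of τ ^ i : End X) := by
  let P : End X := ∑ i ∈ Finset.range N, End.of τ ^ i
  have hP1 : (𝟙 X - τ) ≫ P = 0 := by
    have h : P * (1 - End.of τ) = 0 := by rw [geom_sum_mul_neg, hτN, sub_self]
    exact h
  have hP2 : P ≫ τ = P := by
    have h : (1 - End.of τ) * P = 0 := by rw [mul_neg_geom_sum, hτN, sub_self]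
    rw [sub_mul, one_mul, sub_eq_zero] at h
    exact h.symm
  have hP3 : P ≫ π = N • π := by
    have hpow : ∀ i : ℕ, (show X ⟶ X from End.of τ ^ i) ≫ π = π := by
      intro i
      induction i with
      | zero => exact Category.id_comp π
      | succ i ih =>
        have h : (show X ⟶ X from End.of τ ^ (i + 1)) = τ ≫ (show X ⟶ X from End.of τ ^ i) :=
          pow_succ (End.of τ) i
        rw [h, Category.assoc, ih, hτπ]
    refine (Preadditive.sum_comp (Finset.range N)
      (fun i => (show X ⟶ X from End.of τ ^ i)) π).trans ?_
    rw [Finset.sum_congr rfl fun i _ => hpow i, Finset.sum_const, Finset.card_range]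
  -- the norm vanishes on the image of `1 - τ`
  have : Epi (ShortComplex.mk (𝟙 X - τ) π w).g := hπ
  let s₀ : Z ⟶ X := hS.desc P hP1
  have hs₀ : π ≫ s₀ = P := hS.g_desc P hP1
  refine ⟨r ≫ s₀, ?_, ?_, ?_⟩
  · have h : s₀ ≫ π = N • 𝟙 Z := by
      rw [← cancel_epi π, ← Category.assoc, hs₀, hP3, Preadditive.comp_nsmul, Category.comp_id]
    rw [Category.assoc, h, Preadditive.comp_nsmul, Category.comp_id, hr]
  · rw [Category.assoc]
    congr 1
    rw [← cancel_epi π, ← Category.assoc, hs₀, hP2]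
  · rw [← Preadditive.comp_nsmul, ← Preadditive.nsmul_comp, hr, Category.id_comp, hs₀]

variable [HasExt C]

theorem comp_mk₀_eq_sub_add {X' : C} {i : ℕ} (x : Abelian.Ext X' X i) :
    x = x.comp (Ext.mk₀ (𝟙 X - τ)) (add_zero i) + x.comp (Ext.mk₀ τ) (add_zero i) := by
  rw [← Ext.comp_add, ← Ext.mk₀_add, sub_add_cancel, Ext.comp_mk₀_id]

theorem mk₀_comp_eq_sub_add {i : ℕ} (x : Abelian.Ext X Y i) :
    x = (Ext.mk₀ (𝟙 X - τ)).comp x (zero_add i) + (Ext.mk₀ τ).comp x (zero_add i) := by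
  rw [← Ext.add_comp, ← Ext.mk₀_add, sub_add_cancel, Ext.mk₀_id_comp]

section ShortExact

variable {w : (𝟙 X - τ) ≫ π = 0} (hS : (ShortComplex.mk (𝟙 X - τ) π w).ShortExact)

include hS

/-- The class of `0 → X → X → Z → 0`, with first map `1 - τ`, is `τ`-invariant. -/
theorem extClass_comp_mk₀_eq_self :
    hS.extClass.comp (Ext.mk₀ τ) (add_zero 1) = hS.extClass := by
  have h := comp_mk₀_eq_sub_add (τ := τ) hS.extClass
  have h0 : hS.extClass.comp (Ext.mk₀ (𝟙 X - τ)) (add_zero 1) = 0 := hS.extClass_comp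
  rw [h0, zero_add] at h
  exact h.symm

theorem extClass_comp_surjective {n : ℕ} (h : Subsingleton (Abelian.Ext X Y (n + 1)))
    (x : Abelian.Ext Z Y (n + 1)) :
    ∃ y : Abelian.Ext X Y n, hS.extClass.comp y (Nat.add_comm 1 n) = x :=
  Ext.contravariant_sequence_exact₃ hS Y x (Subsingleton.elim _ _) _

theorem exists_eq_add_of_extClass_comp_eq_zero {n : ℕ} {x : Abelian.Ext X Y n}
    (hx : hS.extClass.comp x (Nat.add_comm 1 n) = 0) :
    ∃ y : Abelian.Ext X Y n, y = x + (Ext.mk₀ τ).comp y (zero_add n) := by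
  obtain ⟨y, hy⟩ := Ext.contravariant_sequence_exact₁ hS Y x _ hx
  exact ⟨y, by conv_lhs => rw [mk₀_comp_eq_sub_add (τ := τ) y]
               exact congrArg (· + _) hy⟩

/-- If `Ext^i(X, Y)` vanishes for `i ≠ n` and `1 - τ` is injective on `Ext^n(X, Y)`, then
`Ext^i(Z, Y)` vanishes for `i ≠ n + 1`. -/
theorem subsingleton_ext_of_shortExact {n : ℕ}
    (hvan : ∀ i, i ≠ n → Subsingleton (Abelian.Ext X Y i))
    (hinj : ∀ y : Abelian.Ext X Y n, (Ext.mk₀ τ).comp y (zero_add n) = y → y = 0)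
    {i : ℕ} (hi : i ≠ n + 1) : Subsingleton (Abelian.Ext Z Y i) := by
  have hepi : Epi π := hS.epi_g
  have key : ∀ x : Abelian.Ext Z Y i, (Ext.mk₀ π).comp x (zero_add i) = 0 := by
    intro x
    by_cases hin : i = n
    · subst hin
      refine hinj _ ?_
      have h := mk₀_comp_eq_sub_add (τ := τ) ((Ext.mk₀ π).comp x (zero_add i))
      rw [Ext.mk₀_comp_mk₀_assoc, w, Ext.mk₀_zero, Ext.zero_comp, zero_add] at h
      exact h.symm
    · exact (hvan i hin).elim _ _
  refine subsingleton_of_forall_eq 0 fun x => ?_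
  cases i with
  | zero =>
    obtain ⟨f, rfl⟩ := (Ext.mk₀_bijective Z Y).2 x
    have h := key (Ext.mk₀ f)
    rw [Ext.mk₀_comp_mk₀, Ext.mk₀_eq_zero_iff] at h
    rw [Ext.mk₀_eq_zero_iff, ← cancel_epi π, h, Limits.comp_zero]
  | succ j =>
    obtain ⟨y, rfl⟩ := Ext.contravariant_sequence_exact₃ hS Y x (key x) (Nat.add_comm 1 j)
    rw [(hvan j fun h => hi (h ▸ rfl)).elim y 0, Ext.comp_zero]

end ShortExact

section Split

variable {s : Z ⟶ X} (hs : s ≫ π = 𝟙 Z)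

include hs

theorem mk₀_comp_surjective {n : ℕ} (x : Abelian.Ext Z Y n) :
    ∃ y : Abelian.Ext X Y n, (Ext.mk₀ s).comp y (zero_add n) = x :=
  ⟨(Ext.mk₀ π).comp x (zero_add n), by rw [Ext.mk₀_comp_mk₀_assoc, hs, Ext.mk₀_id_comp]⟩

theorem subsingleton_ext_of_section {i : ℕ} (h : Subsingleton (Abelian.Ext X Y i)) :
    Subsingleton (Abelian.Ext Z Y i) := by
  refine subsingleton_of_forall_eq 0 fun x => ?_
  obtain ⟨y, rfl⟩ := mk₀_comp_surjective hs x
  rw [h.elim y 0, Ext.comp_zero]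

end Split

/-- If `T` is a `τ`-invariant functional on `Ext^n(X, Y)` and `s : Z ⟶ X` is such that `N (π ≫ s)` is
the norm `∑_{i < N} τ^i`, then `N T` vanishes on the kernel of the restriction along `s`. -/
theorem nsmul_eq_zero_of_mk₀_comp_eq_zero {s : Z ⟶ X} {N : ℕ}
    (hN : N • (π ≫ s) = (∑ i ∈ Finset.range N, End.of τ ^ i : End X))
    {B : Type*} [AddCommGroup B] {n : ℕ} (T : Abelian.Ext X Y n →+ B)
    (hT : ∀ x, T ((Ext.mk₀ τ).comp x (zero_add n)) = T x) {x : Abelian.Ext X Y n}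
    (hx : (Ext.mk₀ s).comp x (zero_add n) = 0) : N • T x = 0 := by
  let L : End X →+ B := T.comp (((Ext.bilinearComp X X Y 0 n n (zero_add n)).flip x).comp
    (Ext.addEquiv₀ (X := X) (Y := X)).symm.toAddMonoidHom)
  have hL : ∀ f : X ⟶ X, L f = T ((Ext.mk₀ f).comp x (zero_add n)) := fun f => rfl
  have hpow : ∀ i : ℕ, L (End.of τ ^ i) = T x := by
    intro i
    induction i with
    | zero => exact congrArg T (Ext.mk₀_id_comp x)
    | succ i ih =>
      rw [← ih, hL (End.of τ ^ i), ← hT, Ext.mk₀_comp_mk₀_assoc, pow_succ]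
      rfl
  have h : N • L (π ≫ s) = ∑ i ∈ Finset.range N, L (End.of τ ^ i) := by
    rw [← map_sum L, ← hN]
    exact (map_nsmul L N (π ≫ s)).symm
  rw [hL, ← Ext.mk₀_comp_mk₀_assoc, hx, Ext.comp_zero, map_zero, smul_zero,
    Finset.sum_congr rfl fun i _ => hpow i, Finset.sum_const, Finset.card_range] at h
  exact h.symm

end Descent

/-! ### The smash product is Calabi–Yau -/

section CalabiYau

open Abelian

variable {k : Type u} {A : Type v} [Field k] [Ring A] [Algebra k A] {μ : A ≃ₐ[k] A}

theorem one_sub_swapEnd_comp_mulMap : (𝟙 _ - swapEnd μ) ≫ mulMap _ = 0 := by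
  rw [Preadditive.sub_comp, swapEnd_comp_mulMap, Category.id_comp, sub_self]

variable (μ) in
/-- The complex `B ⊗_A B → B ⊗_A B → B` of `B`-bimodules for `B = A ♯ k⟨μ⟩`, in which the first map
is `x ⊗ y ↦ x ⊗ y - x μ⁻¹ ⊗ μ y`. -/
abbrev smashComplex : ShortComplex (ModuleCat.{v} (Env k (Smash (Subgroup.zpowers μ)))) :=
  ShortComplex.mk (𝟙 _ - swapEnd μ) (mulMap _) one_sub_swapEnd_comp_mulMap

theorem smashComplex_exact : Function.Exact (smashComplex μ).f.hom (smashComplex μ).g.hom := by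
  intro c
  constructor
  · intro hc
    obtain ⟨d, hd⟩ := exists_sub_swapEnd_eq μ hc
    exact ⟨d, hd⟩
  · rintro ⟨d, rfl⟩
    exact ConcreteCategory.congr_hom (one_sub_swapEnd_comp_mulMap (μ := μ)) d

theorem smashComplex_injective (hμ : ¬ IsOfFinOrder μ) :
    Function.Injective (smashComplex μ).f.hom := by
  rw [injective_iff_map_eq_zero]
  intro c hc
  exact eq_zero_of_swapEnd_eq μ hμ (sub_eq_zero.1 hc).symm

theorem mulMap_epi (G : Subgroup (A ≃ₐ[k] A)) : Epi (mulMap (k := k) G) :=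
  (ModuleCat.epi_iff_surjective _).2 (mulMap_surjective G)

theorem smashComplex_shortExact (hμ : ¬ IsOfFinOrder μ) : (smashComplex μ).ShortExact where
  exact := (ShortComplex.ShortExact.moduleCat_exact_iff_function_exact _).2 smashComplex_exact
  mono_f := (ModuleCat.mono_iff_injective _).2 (smashComplex_injective hμ)
  epi_g := mulMap_epi _

/-- `swapEnd μ` has order dividing that of `μ`: in coordinates it is a translation by `μ⁻¹`. For `μ`
of infinite order the statement is the trivial one about the power with exponent `0`. -/
theorem swapEnd_pow_orderOf :
    End.of (swapEnd μ) ^ orderOf μ = 1 := by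
  have hpow : ∀ (i : ℕ) (c : inducedBimodule (Subgroup.zpowers μ)),
      inducedCoord _ ((show inducedBimodule (Subgroup.zpowers μ) ⟶ _ from
        End.of (swapEnd μ) ^ i).hom c) =
        shift ((zgen μ)⁻¹ ^ i) (inducedCoord _ c) := by
    intro i
    induction i with
    | zero => exact fun c => (shift_one _).symm
    | succ i ih =>
      intro c
      rw [pow_succ, pow_succ, ← shift_shift, ← inducedCoord_swapEnd]
      exact ih ((swapEnd μ).hom c)
  have hz : (zgen μ)⁻¹ ^ orderOf μ = 1 := by
    rw [inv_pow, inv_eq_one]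
    exact Subtype.ext (pow_orderOf_eq_one μ)
  apply ModuleCat.hom_ext
  refine LinearMap.ext fun c => (inducedCoord _).injective ((hpow _ c).trans ?_)
  rw [hz, shift_one]
  rfl

/-- Multiplication by a scalar `c ∈ k` on a `Bᵉ`-module. -/
def scalarEnd {B : Type v} [Ring B] [Algebra k B] (M : ModuleCat.{v} (Env k B)) (c : k) : M ⟶ M :=
  ModuleCat.ofHom
    { toFun := fun x => algebraMap k (Env k B) c • x
      map_add' := smul_add _
      map_smul' := fun r x => by
        rw [RingHom.id_apply, ← mul_smul, ← mul_smul, Algebra.commutes] }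

theorem nsmul_scalarEnd_inv {B : Type v} [Ring B] [Algebra k B] (M : ModuleCat.{v} (Env k B))
    {N : ℕ} (hN : (N : k) ≠ 0) : N • scalarEnd M (N : k)⁻¹ = 𝟙 M := by
  apply ModuleCat.hom_ext
  refine LinearMap.ext fun x => ?_
  change N • (algebraMap k (Env k B) (N : k)⁻¹ • x) = x
  rw [← Nat.cast_smul_eq_nsmul (Env k B), ← mul_smul, ← map_natCast (algebraMap k (Env k B)),
    ← map_mul, mul_inv_cancel₀ hN, map_one, one_smul]

/-- If the order of `μ` is finite and invertible in `k`, the multiplication `B ⊗_A B → B` has a section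
which is invariant under `x ⊗ y ↦ x μ⁻¹ ⊗ μ y`. The hypothesis implies that the order is finite
because `orderOf μ` is `0` otherwise. -/
theorem exists_mulMap_section (hN : (orderOf μ : k) ≠ 0) :
    ∃ s : regularBimodule k (Smash (Subgroup.zpowers μ)) ⟶ inducedBimodule (Subgroup.zpowers μ),
      s ≫ mulMap _ = 𝟙 _ ∧ s ≫ swapEnd μ = s ∧
        orderOf μ • (mulMap _ ≫ s) = (∑ i ∈ Finset.range (orderOf μ),
          End.of (swapEnd μ) ^ i) :=
  exists_nsmul_section swapEnd_pow_orderOf (swapEnd_comp_mulMap μ) one_sub_swapEnd_comp_mulMap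
    ((ShortComplex.ShortExact.moduleCat_exact_iff_function_exact (smashComplex μ)).2
      smashComplex_exact)
    (mulMap_epi _) (nsmul_scalarEnd_inv _ hN)

/-- A bijection `B → Ext^p_{Bᵉ}(B, Bᵉ)` which respects both actions of `B` makes the identity a
Nakayama automorphism. -/
theorem isNakayama_refl_of_bijective {B : Type v} [Ring B] [Algebra k B] {p : ℕ}
    (ψ : B →+ DualExt k B p) (hinj : ∀ b, ψ b = 0 → b = 0) (hsurj : Function.Surjective ψ)
    (hlact : ∀ a b, lact a (ψ b) = ψ (a * b)) (hract : ∀ b a, ract (ψ b) a = ψ (b * a)) :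
    IsNakayama k B p AlgEquiv.refl := by
  let Ψ := AddEquiv.ofBijective ψ ⟨(injective_iff_map_eq_zero ψ).2 hinj, hsurj⟩
  refine ⟨Ψ.symm, fun a b x => ?_⟩
  obtain ⟨y, rfl⟩ := Ψ.surjective x
  rw [Ψ.symm_apply_apply, AddEquiv.symm_apply_eq]
  change ract (lact a (ψ y)) b = ψ (a * y * b)
  rw [hlact, hract]

section

variable {n m : ℕ} {e : DualExt k A n}
  (hA : HasFiniteResolution (Env k A) m (regularBimodule k A))
  (he : IsFreeGenerator e) (hμ : ∀ a : A, ract e a = lact (μ a) e)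

/-- The sum of the coordinates, on `Ext^n_{Bᵉ}(B ⊗_A B, Bᵉ)`. -/
def totalExt :
    Abelian.Ext (inducedBimodule (Subgroup.zpowers μ))
      (envModule k (Smash (Subgroup.zpowers μ))) n →+ Smash (Subgroup.zpowers μ) :=
  (total _ (Smash (Subgroup.zpowers μ))).comp (extCoord hA he hμ).symm.toAddMonoidHom

theorem totalExt_extCoord (c : Subgroup.zpowers μ →₀ Smash (Subgroup.zpowers μ)) :
    totalExt hA he hμ (extCoord hA he hμ c) = total _ (Smash (Subgroup.zpowers μ)) c :=
  congrArg (total _ _) ((extCoord hA he hμ).symm_apply_apply c)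

theorem totalExt_swapEnd_comp (hfix : autAct μ⁻¹ e = e)
    (x : Abelian.Ext (inducedBimodule (Subgroup.zpowers μ))
      (envModule k (Smash (Subgroup.zpowers μ))) n) :
    totalExt hA he hμ ((Ext.mk₀ (swapEnd μ)).comp x (zero_add n)) = totalExt hA he hμ x := by
  obtain ⟨c, rfl⟩ := (extCoord hA he hμ).surjective x
  rw [swapEnd_comp_extCoord hA he hμ hfix, totalExt_extCoord, totalExt_extCoord, total_shift]

/-- A class `κ ∈ Ext(B, B ⊗_A B)` such that the product with `κ` presents `Ext^p_{Bᵉ}(B, Bᵉ)` as the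
coinvariants of `x ⊗ y ↦ x μ⁻¹ ⊗ μ y` on `Ext^n_{Bᵉ}(B ⊗_A B, Bᵉ)` identifies the bimodule
`Ext^p_{Bᵉ}(B, Bᵉ)` with `B`, by means of the sum of the coordinates. -/
theorem isNakayama_refl (hfix : autAct μ⁻¹ e = e) {c p : ℕ} (hp : c + n = p)
    (κ : Abelian.Ext (regularBimodule k (Smash (Subgroup.zpowers μ)))
      (inducedBimodule (Subgroup.zpowers μ)) c)
    (hκ : κ.comp (Ext.mk₀ (swapEnd μ)) (add_zero c) = κ)
    (hsurj : ∀ x : DualExt k (Smash (Subgroup.zpowers μ)) p, ∃ y, κ.comp y hp = x)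
    (hker : ∀ y, κ.comp y hp = 0 → totalExt hA he hμ y = 0) :
    IsNakayama k (Smash (Subgroup.zpowers μ)) p AlgEquiv.refl := by
  let φ := extCoord hA he hμ
  let L : (Subgroup.zpowers μ →₀ Smash (Subgroup.zpowers μ)) →+
      DualExt k (Smash (Subgroup.zpowers μ)) p :=
    (κ.precomp (envModule k (Smash (Subgroup.zpowers μ))) hp).comp φ.toAddMonoidHom
  have hL : ∀ d, L d = κ.comp (φ d) hp := fun d => rfl
  let ψ : Smash (Subgroup.zpowers μ) →+ DualExt k (Smash (Subgroup.zpowers μ)) p :=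
    L.comp (Finsupp.singleAddHom 1)
  have hψ : ∀ b, ψ b = κ.comp (φ (Finsupp.single 1 b)) hp := fun b => rfl
  have hshift : ∀ d, L (shift (zgen μ)⁻¹ d) = L d := by
    intro d
    rw [hL, hL, ← swapEnd_comp_extCoord hA he hμ hfix, ← Ext.comp_assoc_of_second_deg_zero, hκ]
  have key : ∀ d, κ.comp (φ d) hp = ψ (total _ _ d) :=
    apply_eq_apply_single_total (zgen_generates μ) L hshift
  have hinj : ∀ b, ψ b = 0 → b = 0 := by
    intro b hb
    have h := hker (φ (Finsupp.single 1 b)) hb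
    rwa [totalExt_extCoord, total_single] at h
  have hsur : Function.Surjective ψ := by
    intro x
    obtain ⟨y, rfl⟩ := hsurj x
    obtain ⟨d, rfl⟩ := φ.surjective y
    exact ⟨_, (key d).symm⟩
  have hlact : ∀ a b, lact a (ψ b) = ψ (a * b) := by
    intro a b
    rw [hψ, lact, Ext.comp_assoc_of_third_deg_zero, extCoord_comp_rightMul_op, hψ]
  have hract : ∀ b a, ract (ψ b) a = ψ (b * a) := by
    intro b a
    induction a using smash_induction with
    | zero =>
      have h := ract_add (ψ b) 0 0
      rw [add_zero, left_eq_add] at h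
      rw [h, mul_zero, map_zero]
    | add x y hx hy => rw [ract_add, hx, hy, mul_add, map_add]
    | incl_mul_gen a g =>
      rw [hψ, ract, Ext.comp_assoc_of_third_deg_zero, extCoord_comp_rightMul, key, total_single]
  exact isNakayama_refl_of_bijective ψ hinj hsur hlact hract

end

theorem isHomologicallySmooth_of_hasFiniteResolution {B : Type v} [Ring B] [Algebra k B] {m : ℕ}
    (h : HasFiniteResolution (Env k B) m (regularBimodule k B)) : IsHomologicallySmooth k B := by
  obtain ⟨P, h₁, h₂⟩ := h.exists_projectiveResolution
  exact ⟨P, m, h₁, h₂⟩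

section

variable {n m : ℕ} {e : DualExt k A n}
  (hA : HasFiniteResolution (Env k A) m (regularBimodule k A))
  (hvan : ∀ i, i ≠ n → Subsingleton (DualExt k A i))
  (he : IsFreeGenerator e) (hμ : ∀ a : A, ract e a = lact (μ a) e) (hfix : autAct μ⁻¹ e = e)

include hA hvan he hμ hfix

/-- For `μ` of infinite order, the long exact sequence of `0 → B ⊗_A B → B ⊗_A B → B → 0` raises the
dimension by one. -/
theorem isCalabiYauOfDim_of_not_isOfFinOrder (hord : ¬ IsOfFinOrder μ) :
    IsCalabiYauOfDim k (Smash (Subgroup.zpowers μ)) (n + 1) := by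
  have hS := smashComplex_shortExact hord
  have hvan' : ∀ i, i ≠ n → Subsingleton (Abelian.Ext (inducedBimodule (Subgroup.zpowers μ))
      (envModule k (Smash (Subgroup.zpowers μ))) i) :=
    fun i hi => subsingleton_ext_inducedBimodule hA (hvan i hi)
  have hind := (envRightBasis (Subgroup.zpowers μ)).hasFiniteResolution_induced hA
  refine ⟨isHomologicallySmooth_of_hasFiniteResolution (HasFiniteResolution.of_cokernel
    (smashComplex_injective hord) (mulMap_surjective _) smashComplex_exact hind hind), ?_, ?_⟩
  · intro i hi
    refine subsingleton_ext_of_shortExact hS hvan' (fun y hy => ?_) hi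
    -- a `μ`-invariant class has translation invariant coordinates
    obtain ⟨c, rfl⟩ := (extCoord hA he hμ).surjective y
    rw [swapEnd_comp_extCoord hA he hμ hfix] at hy
    rw [eq_zero_of_shift_eq (mt (zgen_isOfFinOrder μ).1 hord) ((extCoord hA he hμ).injective hy),
      map_zero]
  · refine isNakayama_refl hA he hμ hfix (Nat.add_comm 1 n) hS.extClass
      (extClass_comp_mk₀_eq_self hS)
      (extClass_comp_surjective hS (hvan' (n + 1) n.succ_ne_self)) fun y hy => ?_
    obtain ⟨z, hz⟩ := exists_eq_add_of_extClass_comp_eq_zero hS hy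
    have h := congrArg (totalExt hA he hμ) hz
    -- the sum of the coordinates vanishes on the image of `1 - τ`
    rwa [map_add, totalExt_swapEnd_comp hA he hμ hfix, right_eq_add] at h

/-- For `μ` of finite order invertible in `k`, the bimodule `B` is a direct summand of `B ⊗_A B` and
the dimension does not change. -/
theorem isCalabiYauOfDim_of_orderOf_ne_zero (hord : (orderOf μ : k) ≠ 0) :
    IsCalabiYauOfDim k (Smash (Subgroup.zpowers μ)) n := by
  obtain ⟨s, hs, hsτ, hN⟩ := exists_mulMap_section hord
  have hind := (envRightBasis (Subgroup.zpowers μ)).hasFiniteResolution_induced hA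
  refine ⟨isHomologicallySmooth_of_hasFiniteResolution
    (hind.of_retract s.hom (mulMap _).hom (congrArg ModuleCat.Hom.hom hs)), ?_, ?_⟩
  · exact fun i hi => subsingleton_ext_of_section hs
      (subsingleton_ext_inducedBimodule hA (hvan i hi))
  · refine isNakayama_refl hA he hμ hfix (zero_add n) (Ext.mk₀ s)
      (by rw [Ext.mk₀_comp_mk₀, hsτ]) (mk₀_comp_surjective hs) fun y hy => ?_
    have h := nsmul_eq_zero_of_mk₀_comp_eq_zero hN (totalExt hA he hμ)
      (totalExt_swapEnd_comp hA he hμ hfix) hy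
    rw [← Nat.cast_smul_eq_nsmul k] at h
    exact (smul_eq_zero.1 h).resolve_left hord

end

end CalabiYau

end

end CYSmash


theorem mainTheorem10 {k : Type u} {A : Type v} [Field k] [Ring A] [Algebra k A]
    (n : ℕ) (hA : CYSmash.IsSkewCalabiYau k A n)
    (e : CYSmash.DualExt k A n) (he : CYSmash.IsFreeGenerator e)
    (μ : A ≃ₐ[k] A) (hμ : ∀ a : A, CYSmash.ract e a = CYSmash.lact (μ a) e)
    (whdet : MonoidAlgebra k (Subgroup.zpowers μ) →ₗ[k] A)
    (hwhdet : CYSmash.IsWeakHomologicalDeterminant (Subgroup.zpowers μ) e whdet)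
    (hdet : whdet (MonoidAlgebra.of k _ ⟨μ, Subgroup.mem_zpowers μ⟩) = 1)
    (hord : IsOfFinOrder μ → ¬ ringChar k ∣ orderOf μ) :
    CYSmash.IsCalabiYau k (CYSmash.Smash (Subgroup.zpowers μ)) := by
  obtain ⟨⟨P, m, hfin, hzero⟩, hvan, -⟩ := hA
  have hA' := CYSmash.exists_hasFiniteResolution P hfin hzero
  have hfix := CYSmash.autAct_inv_eq_self he μ hwhdet hdet
  by_cases h : IsOfFinOrder μ
  · exact ⟨n, CYSmash.isCalabiYauOfDim_of_orderOf_ne_zero hA' hvan he hμ hfix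
      (mt (ringChar.spec k _).1 (hord h))⟩
  · exact ⟨n + 1, CYSmash.isCalabiYauOfDim_of_not_isOfFinOrder hA' hvan he hμ hfix h⟩
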